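/- Let $d\ge 1$ and let $\Omega\subset\mathbb R^d$ be a bounded open set with Lipschitz boundary. Let $s,a,f_w,f_2:\mathbb R\to\mathbb R$ and $\mathbf f_1,\mathbf f_3:\mathbb R\to\mathbb R^d$ satisfy: (A1) $s$ takes values in $[0,1]$ and is nondecreasing and Lipschitz continuous; (A2) $a$ is Lipschitz continuous and there are $a_\star,a^\star$ with $0<a_\star\le a(y)\le a^\star<\infty$ for all $y\in\mathbb R$; (A3) $\mathbf f_1,f_2,\mathbf f_3,f_w$ are Lipschitz continuous and $f_w$ is bounded. Let $\mathcal T_h$ be a conforming decomposition of $\overline\Omega$ into finitely many closed $d$-simplices (any two of them meet at most in a common face). Let $W_h\subset L^2(\Omega)$ be the space of functions that are constant on each $T\in\mathcal T_h$, and let $V_h$ be the lowest order Raviart--Thomas space of those $\mathbf v\in H(\mathrm{div};\Omega)$ that on each $T\in\mathcal T_h$ have the form $\mathbf v(\mathbf x)=\mathbf a_T+b_T\mathbf x$ with $\mathbf a_T\in\mathbb R^d$, $b_T\in\mathbb R$. Write $\langle\cdot,\cdot\rangle$ for the $L^2(\Omega)$ inner product. For a time step $\tau>0$ and a given previous state $\Theta_h^{n-1}\in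 L^2(\Omega)$ (in particular, any element of $W_h$, or the initial datum $\Theta_I\in L^2(\Omega)$ of (A5) if $n=1$), problem $P_h^n$ is to find $\Theta_h^n,p_h^n\in W_h$ and $\mathbf q_h^n,\mathbf u_h^n\in V_h$ such that, with $s_h^n:=s(\Theta_h^n)$ and $s_h^{n-1}:=s(\Theta_h^{n-1})$, \begin{align*} \langle s_h^n-s_h^{n-1},w_h\rangle+\tau\langle\nabla\cdot\mathbf q_h^n,w_h\rangle&=0,\\ \langle\mathbf q_h^n,\mathbf v_h\rangle-\langle\Theta_h^n,\nabla\cdot\mathbf v_h\rangle-\langle f_w(s_h^n)\mathbf u_h^n,\mathbf v_h\rangle&=\langle\mathbf f_1(s_h^n),\mathbf v_h\rangle,\\ \langle\nabla\cdot\mathbf u_h^n,w_h\rangle&=\langle f_2(s_h^n),w_h\rangle,\\ \langle a(s_h^n)\mathbf u_h^n,\mathbf v_h\rangle-\langle p_h^n,\nabla\cdot\mathbf v_h\rangle+\langle\mathbf f_3(s_h^n),\mathbf v_h\rangle&=0 \end{align*} for all $w_h\in W_h$ and all $\mathbf v_h\in V_h$. Then for all $\sigma,M_{\mathbf u}\in\mathbb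 R$ there is $\tau_0>0$, depending only on $d$, $\Omega$, the coefficient functions, $\sigma$ and $M_{\mathbf u}$, such that the following holds for every such decomposition $\mathcal T_h$ that is shape regular with constant $\sigma$ (each $T\in\mathcal T_h$ contains a ball of some diameter $\rho>0$ with $\operatorname{diam}T\le\sigma\rho$), every $\tau\in(0,\tau_0]$ and every $\Theta_h^{n-1}\in L^2(\Omega)$: if (A4) every solution of $P_h^n$ satisfies $\|\mathbf u_h^n\|_{L^\infty(\Omega)}\le M_{\mathbf u}$, then $P_h^n$ has at most one solution $(\Theta_h^n,\mathbf q_h^n,p_h^n,\mathbf u_h^n)$. -/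

import Mathlib

open MeasureTheory Set
open scoped ContDiff NNReal

noncomputable section

/-- The Euclidean space `ℝᵈ`. -/
abbrev Euc (d : ℕ) : Type := EuclideanSpace ℝ (Fin d)

/-- `L²(Ω)`. -/
abbrev L2Scal {d : ℕ} (Ω : Set (Euc d)) : Type := Lp ℝ 2 (volume.restrict Ω)

/-- `L²(Ω)ᵈ`. -/
abbrev L2Vec {d : ℕ} (Ω : Set (Euc d)) : Type := Lp (Euc d) 2 (volume.restrict Ω)

/-- `Ω` has a Lipschitz boundary: near each boundary point, for a suitable unit vector `e`
(the local vertical direction), `Ω` is the strict epigraph of a Lipschitz function `γ` of the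
component `y - ⟪e, y⟫ e` orthogonal to `e`. -/
def HasLipschitzBoundary {d : ℕ} (Ω : Set (Euc d)) : Prop :=
  ∀ x ∈ frontier Ω, ∃ (e : Euc d) (r : ℝ) (K : ℝ≥0) (γ : Euc d → ℝ),
    ‖e‖ = 1 ∧ 0 < r ∧ LipschitzWith K γ ∧
      ∀ y ∈ Metric.ball x r, (y ∈ Ω ↔ γ (y - inner ℝ e y • e) < inner ℝ e y)

/-- `g` is the weak divergence of `v` in `Ω`, tested with `C_c^∞(Ω)`. -/
def HasWeakDiv {d : ℕ} (Ω : Set (Euc d)) (v : L2Vec Ω) (g : L2Scal Ω) : Prop :=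
  ∀ φ : Euc d → ℝ, ContDiff ℝ ∞ φ → HasCompactSupport φ → tsupport φ ⊆ Ω →
    ∫ x in Ω, inner ℝ (v x) (gradient φ x) = -∫ x in Ω, g x * φ x

/-- The space `H(div; Ω)`: square integrable vector fields with a square integrable weak
divergence. -/
def Hdiv {d : ℕ} (Ω : Set (Euc d)) : Type :=
  {v : L2Vec Ω // ∃ g : L2Scal Ω, HasWeakDiv Ω v g}

namespace Hdiv

variable {d : ℕ} {Ω : Set (Euc d)}

/-- The underlying `L²` vector field. -/
def toL2 (v : Hdiv Ω) : L2Vec Ω := v.1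

/-- The weak divergence `∇ · v` of `v ∈ H(div; Ω)`. -/
def div (v : Hdiv Ω) : L2Scal Ω := v.2.choose

theorem hasWeakDiv_div (v : Hdiv Ω) : HasWeakDiv Ω v.toL2 v.div := v.2.choose_spec

/-- The weak divergence is unique, so `div` does not depend on the choice made. -/
theorem div_eq_of_hasWeakDiv (hΩ : IsOpen Ω) (v : Hdiv Ω) (g : L2Scal Ω)
    (hg : HasWeakDiv Ω v.toL2 g) : v.div = g := by
  have key : ∀ᵐ x ∂(volume : Measure (Euc d)), x ∈ Ω → (v.div x - g x) = 0 := by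
    have hloc : ∀ f : L2Scal Ω, LocallyIntegrableOn f Ω volume := fun f => by
      rw [locallyIntegrableOn_iff hΩ.isLocallyClosed]
      intro k hk hkc
      have h1 : MemLp f 2 (volume.restrict k) :=
        (Lp.memLp f).mono_measure (Measure.restrict_mono hk le_rfl)
      have : IsFiniteMeasure (volume.restrict k) :=
        ⟨by simpa using hkc.measure_lt_top⟩
      exact h1.integrable (by norm_num)
    refine hΩ.ae_eq_zero_of_integral_contDiff_smul_eq_zero ((hloc v.div).sub (hloc g)) ?_
    intro φ hφ hc hs
    have hφ2 : MemLp φ 2 (volume.restrict Ω) :=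
      (hφ.continuous.memLp_of_hasCompactSupport hc).restrict Ω
    have i1 : Integrable (fun x => v.div x * φ x) (volume.restrict Ω) :=
      (Lp.memLp v.div).integrable_mul hφ2
    have i2 : Integrable (fun x => g x * φ x) (volume.restrict Ω) :=
      (Lp.memLp g).integrable_mul hφ2
    have e1 := v.hasWeakDiv_div φ hφ hc hs
    have e2 := hg φ hφ hc hs
    have e3 : ∫ x in Ω, (v.div x * φ x - g x * φ x) = 0 := by
      rw [integral_sub i1 i2]; linarith
    rw [← setIntegral_eq_integral_of_forall_compl_eq_zero (s := Ω), ← e3]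
    · refine integral_congr_ae (Filter.Eventually.of_forall fun x => ?_)
      simp only [smul_eq_mul]; ring
    · intro x hx
      rw [image_eq_zero_of_notMem_tsupport (fun h => hx (hs h)), zero_smul]
  refine Lp.ext ?_
  refine (ae_restrict_iff' hΩ.measurableSet).2 ?_
  filter_upwards [key] with x hx hxΩ
  exact sub_eq_zero.1 (hx hxΩ)

end Hdiv

/-- A conforming decomposition of the closure of `Ω` into finitely many closed `d`-simplices.
A simplex is given by the set of its `d + 1` vertices; two simplices meet at most in a common
face. -/
structure SimplicialMesh {d : ℕ} (Ω : Set (Euc d)) where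
  /-- the vertex sets of the simplices -/
  cells : Finset (Finset (Euc d))
  card_eq : ∀ T ∈ cells, T.card = d + 1
  affineIndependent : ∀ T ∈ cells, AffineIndependent ℝ ((↑) : T → Euc d)
  inter_subset : ∀ S ∈ cells, ∀ T ∈ cells,
    convexHull ℝ (S : Set (Euc d)) ∩ convexHull ℝ (T : Set (Euc d)) ⊆
      convexHull ℝ ((S : Set (Euc d)) ∩ (T : Set (Euc d)))
  cover : ⋃ T ∈ cells, convexHull ℝ (T : Set (Euc d)) = closure Ω

namespace SimplicialMesh

variable {d : ℕ} {Ω : Set (Euc d)}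

/-- Shape regularity with constant `σ`: every simplex `T` contains a ball of some diameter
`2 r > 0` with `diam T ≤ σ · 2 r`. -/
def IsShapeRegular (M : SimplicialMesh Ω) (σ : ℝ) : Prop :=
  ∀ T ∈ M.cells, ∃ (c : Euc d) (r : ℝ), 0 < r ∧
    Metric.closedBall c r ⊆ convexHull ℝ (T : Set (Euc d)) ∧
      Metric.diam (convexHull ℝ (T : Set (Euc d))) ≤ σ * (2 * r)

/-- `W_h`: the functions in `L²(Ω)` that are constant on each simplex. -/
def Wh (M : SimplicialMesh Ω) : Set (L2Scal Ω) :=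
  {w | ∀ T ∈ M.cells, ∃ c : ℝ,
    ∀ᵐ x ∂(volume.restrict Ω), x ∈ convexHull ℝ (T : Set (Euc d)) → w x = c}

/-- `V_h`, the lowest order Raviart-Thomas space: the fields in `H(div; Ω)` that are of the form
`x ↦ a_T + b_T x` on each simplex `T`. -/
def Vh (M : SimplicialMesh Ω) : Set (Hdiv Ω) :=
  {v | ∀ T ∈ M.cells, ∃ (a : Euc d) (b : ℝ),
    ∀ᵐ x ∂(volume.restrict Ω), x ∈ convexHull ℝ (T : Set (Euc d)) → v.toL2 x = a + b • x}

end SimplicialMesh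

/-- The coefficient functions of the two-phase flow model. -/
structure FlowCoeffs (d : ℕ) where
  /-- the saturation as a function of the complementary pressure -/
  s : ℝ → ℝ
  a : ℝ → ℝ
  fw : ℝ → ℝ
  f1 : ℝ → Euc d
  f2 : ℝ → ℝ
  f3 : ℝ → Euc d

/-- The structural assumptions (A1), (A2), (A3) on the coefficient functions. -/
structure FlowCoeffs.Admissible {d : ℕ} (c : FlowCoeffs d) : Prop where
  s_mem : ∀ y, c.s y ∈ Icc (0 : ℝ) 1
  s_mono : Monotone c.s
  s_lip : ∃ K : ℝ≥0, LipschitzWith K c.s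
  a_lip : ∃ K : ℝ≥0, LipschitzWith K c.a
  a_bounds : ∃ aLow aUp : ℝ, 0 < aLow ∧ ∀ y, aLow ≤ c.a y ∧ c.a y ≤ aUp
  f1_lip : ∃ K : ℝ≥0, LipschitzWith K c.f1
  f2_lip : ∃ K : ℝ≥0, LipschitzWith K c.f2
  f3_lip : ∃ K : ℝ≥0, LipschitzWith K c.f3
  fw_lip : ∃ K : ℝ≥0, LipschitzWith K c.fw
  fw_bdd : ∃ B : ℝ, ∀ y, |c.fw y| ≤ B

/-- A quadruple `(Θ, q, p, u)` of unknowns at one time level. -/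
structure FlowState {d : ℕ} (Ω : Set (Euc d)) where
  Θ : L2Scal Ω
  q : Hdiv Ω
  p : L2Scal Ω
  u : Hdiv Ω

/-- `X = (Θ, q, p, u)` solves the fully discrete problem `P_hⁿ` (backward Euler in time with step
`τ`, lowest order Raviart-Thomas mixed finite elements in space), where `Θprev` is the
complementary pressure at the previous time level. -/
structure IsDiscreteSolution {d : ℕ} {Ω : Set (Euc d)} (c : FlowCoeffs d)
    (M : SimplicialMesh Ω) (τ : ℝ) (Θprev : L2Scal Ω) (X : FlowState Ω) : Prop where
  Θ_mem : X.Θ ∈ M.Wh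
  q_mem : X.q ∈ M.Vh
  p_mem : X.p ∈ M.Wh
  u_mem : X.u ∈ M.Vh
  saturation_eq : ∀ w ∈ M.Wh,
    (∫ x in Ω, (c.s (X.Θ x) - c.s (Θprev x)) * w x) + τ * (∫ x in Ω, X.q.div x * w x) = 0
  flux_eq : ∀ v ∈ M.Vh,
    (∫ x in Ω, inner ℝ (X.q.toL2 x) (v.toL2 x)) - (∫ x in Ω, X.Θ x * v.div x)
        - (∫ x in Ω, inner ℝ (c.fw (c.s (X.Θ x)) • X.u.toL2 x) (v.toL2 x))
      = ∫ x in Ω, inner ℝ (c.f1 (c.s (X.Θ x))) (v.toL2 x)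
  total_flux_eq : ∀ w ∈ M.Wh,
    (∫ x in Ω, X.u.div x * w x) = ∫ x in Ω, c.f2 (c.s (X.Θ x)) * w x
  pressure_eq : ∀ v ∈ M.Vh,
    (∫ x in Ω, inner ℝ (c.a (c.s (X.Θ x)) • X.u.toL2 x) (v.toL2 x))
        - (∫ x in Ω, X.p x * v.div x)
        + (∫ x in Ω, inner ℝ (c.f3 (c.s (X.Θ x))) (v.toL2 x)) = 0

/-- The bound (A4) for the total flux: every solution of `P_hⁿ` satisfies `‖u‖_∞ ≤ Mu`. -/
def TotalFluxBound {d : ℕ} {Ω : Set (Euc d)} (c : FlowCoeffs d)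
    (M : SimplicialMesh Ω) (τ : ℝ) (Θprev : L2Scal Ω) (Mu : ℝ) : Prop :=
  ∀ X : FlowState Ω, IsDiscreteSolution c M τ Θprev X →
    ∀ᵐ x ∂(volume.restrict Ω), ‖X.u.toL2 x‖ ≤ Mu

end

noncomputable section

/-! ### Radial integration over cones. -/

section Cone

/-! Uniqueness is an energy estimate. Let `S`, `Q`, `P`, `U` be the differences of saturation, flux,
pressure and total flux of two solutions. Testing the saturation equation with the difference of the
`Θ` and the flux equation with `Q` gives `⟪S, ΔΘ⟫ + τ‖Q‖² = τ⟪G, Q⟫`, where the Lipschitz bounds and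
(A4) yield `‖G‖ ≤ B‖U‖ + k‖S‖`. As `s` is monotone and Lipschitz, `‖S‖² ≤ L⟪S, ΔΘ⟫`. Testing the
pressure equation with `U` and the total flux equation with `P` bounds `‖U‖²` by `‖S‖(‖U‖ + ‖P‖)`,
and an inf-sup condition bounds `‖P‖` by `‖U‖ + ‖S‖`, up to constants. Hence `‖U‖` is controlled by
`‖S‖`, and for small `τ` the right-hand side is absorbed, so that `S`, `Q`, `U`, `P` vanish
(`exists_timeStep_collapse`). Since `s` need not be injective, `S = 0` does not give `ΔΘ = 0`; this
follows from the inf-sup condition and the flux equation.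

For `τ₀` not to depend on the mesh, the inf-sup constant may depend on `d`, `Ω`, `σ` only
(`exists_infsup`). The field for a given `w ∈ W_h` is explicit, and no elliptic regularity enters.
For `d ≥ 2` its flux through a face `F` is `(diam F)^(d-2)` times the jump of `w`. Its divergence
paired with `w` dominates half the jump energy, a scaling argument bounds its norm by this energy
(`norm_sq_rtHdiv_le`), and a discrete Poincaré inequality bounds `‖w‖` (`sum_sq_le_energy`). The
latter mimics `d ∫ w² = ∫ w² div x`: summation by parts leaves jumps of `w²` weighted by the flux of
the position field `x`. For `d = 1` the faces are points, and a primitive of `w` is used instead.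

That prescribed face fluxes define a field in `H(div; Ω)` rests on the divergence theorem for `x -
z` on a simplex with vertex `z` (`integral_simplex_add_gradient`). This field is tangent to all
faces through `z`, so only the mean over the opposite face appears. The mean is defined from the
vertices of the face alone, hence agrees from both sides, and opposite fluxes cancel. -/

theorem integral_Ioo_pow_mul_add_fderiv {E : Type*} [NormedAddCommGroup E] [NormedSpace ℝ E] {n : ℕ} (hn : 0 < n) {g : E → ℝ} (hg : ContDiff ℝ 1 g)
    (θ : E) :
    ∫ r in Ioo (0 : ℝ) 1, r ^ (n - 1) * (n * g (r • θ) + fderiv ℝ g (r • θ) (r • θ)) = g θ := by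
  have hd : ∀ r : ℝ, HasDerivAt (fun r : ℝ => r ^ n * g (r • θ))
      (r ^ (n - 1) * (n * g (r • θ) + fderiv ℝ g (r • θ) (r • θ))) r := by
    intro r
    have h1 : HasDerivAt (fun r : ℝ => r • θ) θ r := by
      simpa using (hasDerivAt_id r).smul_const θ
    have h2 := ((hg.differentiable (by norm_num)) (r • θ)).hasFDerivAt.comp_hasDerivAt r h1
    have h3 := (hasDerivAt_pow n r).mul h2
    convert! h3 using 1
    obtain ⟨m, rfl⟩ : ∃ m, n = m + 1 := ⟨n - 1, by omega⟩
    simp only [map_smul, smul_eq_mul, Nat.add_sub_cancel, pow_succ]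
    simp only [Function.comp_apply]
    ring
  rw [← integral_Ioc_eq_integral_Ioo, ← intervalIntegral.integral_of_le zero_le_one,
    intervalIntegral.integral_eq_sub_of_hasDerivAt (fun r _ => hd r)]
  · simp [hn.ne']
  · apply Continuous.intervalIntegrable
    have := hg.continuous_fderiv (by norm_num)
    have := hg.continuous
    fun_prop

/-- The radial divergence theorem on the part of an open cone in the unit ball. -/
theorem integral_cone_add_fderiv {E : Type*} [NormedAddCommGroup E] [NormedSpace ℝ E]
    [MeasurableSpace E] [BorelSpace E] [FiniteDimensional ℝ E] [Nontrivial E] (μ : Measure E) [μ.IsAddHaarMeasure] {K : Set E}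
    (hK : MeasurableSet K) (hcone : ∀ x, ∀ t : ℝ, 0 < t → (t • x ∈ K ↔ x ∈ K))
    {g : E → ℝ} (hg : ContDiff ℝ 1 g) :
    ∫ x in K ∩ Metric.ball 0 1, (Module.finrank ℝ E * g x + fderiv ℝ g x x) ∂μ
      = ∫ θ in {θ : Metric.sphere (0 : E) 1 | (θ : E) ∈ K}, g θ ∂μ.toSphere := by
  set n := Module.finrank ℝ E
  have hn : 0 < n := Module.finrank_pos
  set G : E → ℝ := fun x => n * g x + fderiv ℝ g x x with hG
  have hGc : Continuous G := by
    have := hg.continuous_fderiv (by norm_num)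
    have := hg.continuous
    fun_prop
  have hKB : MeasurableSet (K ∩ Metric.ball (0 : E) 1) := hK.inter measurableSet_ball
  set u : E → ℝ := (K ∩ Metric.ball 0 1).indicator G with hu
  have hui : Integrable u μ := by
    rw [hu, integrable_indicator_iff hKB]
    exact (hGc.continuousOn.integrableOn_compact (isCompact_closedBall (0 : E) 1)).mono_set
      (inter_subset_right.trans Metric.ball_subset_closedBall)
  have hmp := μ.measurePreserving_homeomorphUnitSphereProd
  have hemb := (homeomorphUnitSphereProd E).measurableEmbedding
  -- In polar coordinates the measure is `r ^ (n - 1) dr` times the sphere measure; for each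
  -- direction in the cone the radial integral is that of an exact derivative.
  let w : Metric.sphere (0 : E) 1 × Ioi (0 : ℝ) → ℝ := fun q => u ((q.2 : ℝ) • (q.1 : E))
  have hw : ∀ x : ({0}ᶜ : Set E), w (homeomorphUnitSphereProd E x) = u x := by
    intro x
    have hx : ‖(x : E)‖ ≠ 0 := norm_ne_zero_iff.2 x.2
    simp [w, smul_smul, hx]
  have e1 : ∫ x, u x ∂μ = ∫ q, w q ∂(μ.toSphere.prod (.volumeIoiPow (n - 1))) := by
    rw [← hmp.integral_comp hemb]
    simp only [hw]
    rw [integral_subtype_comap (measurableSet_singleton _).compl u, restrict_compl_singleton]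
  have hwi : Integrable w (μ.toSphere.prod (.volumeIoiPow (n - 1))) := by
    rw [← hmp.integrable_comp_emb hemb]
    have : w ∘ (homeomorphUnitSphereProd E) = u ∘ (Subtype.val) := funext hw
    rw [this, ← integrableOn_iff_comap_subtypeVal (measurableSet_singleton _).compl]
    exact hui.integrableOn
  rw [← integral_indicator hKB, ← hu, e1, integral_prod _ hwi]
  have hS : MeasurableSet {θ : Metric.sphere (0 : E) 1 | (θ : E) ∈ K} :=
    measurable_subtype_coe hK
  rw [← integral_indicator hS]
  refine integral_congr_ae (Filter.Eventually.of_forall fun θ => ?_)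
  simp only [Measure.volumeIoiPow, ENNReal.ofReal]
  rw [integral_withDensity_eq_integral_smul
    ((measurable_subtype_coe.pow_const _).real_toNNReal),
    integral_subtype_comap measurableSet_Ioi
      fun a => Real.toNNReal (a ^ (n - 1)) • u (a • (θ : E))]
  have hθn : ‖(θ : E)‖ = 1 := by simp
  by_cases hθ : (θ : E) ∈ K
  · rw [indicator_of_mem (by exact hθ), ← integral_Ioo_pow_mul_add_fderiv hn hg (θ : E),
      ← integral_indicator measurableSet_Ioi, ← integral_indicator measurableSet_Ioo]
    congr 1
    ext r
    by_cases h0 : 0 < r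
    · rw [indicator_of_mem (by exact h0), NNReal.smul_def,
        Real.coe_toNNReal _ (pow_nonneg h0.le _)]
      by_cases h1 : r < 1
      · rw [indicator_of_mem (by exact ⟨h0, h1⟩), hu, indicator_of_mem]
        · simp [hG]
        · exact ⟨(hcone _ _ h0).2 hθ, by simp [norm_smul, hθn, abs_of_pos h0, h1]⟩
      · rw [indicator_of_notMem (fun h => h1 h.2), hu, indicator_of_notMem, smul_zero]
        rintro ⟨-, h⟩
        simp [norm_smul, hθn, abs_of_pos h0] at h
        exact h1 h
    · rw [indicator_of_notMem (by exact h0), indicator_of_notMem (fun h => h0 h.1)]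
  · rw [indicator_of_notMem (by exact hθ)]
    refine setIntegral_eq_zero_of_forall_eq_zero fun r hr => ?_
    rw [hu, indicator_of_notMem, smul_zero]
    rintro ⟨h, -⟩
    exact hθ ((hcone _ _ hr).1 h)

end Cone

/-! ### Barycentric and cone coordinates, and the divergence theorem on a simplex. -/

section Simplex

variable {d : ℕ}

/-- `T` is the vertex set of a nondegenerate `d`-simplex. -/
def IsSimplex (T : Finset (Euc d)) : Prop :=
  T.card = d + 1 ∧ AffineIndependent ℝ ((↑) : T → Euc d)

/-- The affine basis formed by the vertices of a simplex. -/
def IsSimplex.basis {T : Finset (Euc d)} (hT : IsSimplex T) : AffineBasis T ℝ (Euc d) where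
  toFun := (↑)
  ind' := hT.2
  tot' := by
    rw [hT.2.affineSpan_eq_top_iff_card_eq_finrank_add_one]
    simpa using hT.1

open Classical in
/-- The barycentric coordinate of the vertex `z` of the simplex `T`. -/
def bary (T : Finset (Euc d)) (z : Euc d) : Euc d →ᵃ[ℝ] ℝ :=
  if h : IsSimplex T ∧ z ∈ T then h.1.basis.coord ⟨z, h.2⟩ else 0

namespace IsSimplex

theorem bary_eq {T : Finset (Euc d)} (hT : IsSimplex T) {z : Euc d} (hz : z ∈ T) :
    bary T z = hT.basis.coord ⟨z, hz⟩ := by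
  rw [bary, dif_pos ⟨hT, hz⟩]

theorem bary_self {T : Finset (Euc d)} (hT : IsSimplex T) {z : Euc d} (hz : z ∈ T) :
    bary T z z = 1 := by
  rw [hT.bary_eq hz]
  exact hT.basis.coord_apply_eq ⟨z, hz⟩

theorem bary_of_ne {T : Finset (Euc d)} (hT : IsSimplex T) {z w : Euc d} (hz : z ∈ T)
    (hw : w ∈ T) (h : z ≠ w) : bary T z w = 0 := by
  rw [hT.bary_eq hz]
  exact hT.basis.coord_apply_ne (i := ⟨z, hz⟩) (j := ⟨w, hw⟩) (fun e => h (congrArg Subtype.val e))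

theorem sum_bary {T : Finset (Euc d)} (hT : IsSimplex T) (x : Euc d) :
    ∑ z ∈ T, bary T z x = 1 := by
  rw [← Finset.sum_attach, ← hT.basis.sum_coord_apply_eq_one x]
  exact Finset.sum_congr rfl fun z _ => by rw [hT.bary_eq z.2]

theorem range_basis {T : Finset (Euc d)} (hT : IsSimplex T) : range hT.basis = (T : Set (Euc d)) :=
  Subtype.range_coe

theorem mem_convexHull {T : Finset (Euc d)} (hT : IsSimplex T) {x : Euc d} :
    x ∈ convexHull ℝ (T : Set (Euc d)) ↔ ∀ z ∈ T, 0 ≤ bary T z x := by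
  rw [← hT.range_basis, hT.basis.convexHull_eq_nonneg_coord]
  exact ⟨fun h z hz => by rw [hT.bary_eq hz]; exact h _,
    fun h z => by rw [← hT.bary_eq z.2]; exact h _ z.2⟩

theorem mem_interior {T : Finset (Euc d)} (hT : IsSimplex T) {x : Euc d} :
    x ∈ interior (convexHull ℝ (T : Set (Euc d))) ↔ ∀ z ∈ T, 0 < bary T z x := by
  rw [← hT.range_basis, hT.basis.interior_convexHull]
  exact ⟨fun h z hz => by rw [hT.bary_eq hz]; exact h _,
    fun h z => by rw [← hT.bary_eq z.2]; exact h _ z.2⟩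

theorem nonempty_interior {T : Finset (Euc d)} (hT : IsSimplex T) :
    (interior (convexHull ℝ (T : Set (Euc d)))).Nonempty := by
  rw [← hT.range_basis]
  exact ⟨_, hT.basis.centroid_mem_interior_convexHull⟩

theorem bary_eq_of_eqOn {T : Finset (Euc d)} (hT : IsSimplex T) {f g : Euc d →ᵃ[ℝ] ℝ}
    (h : ∀ z ∈ T, f z = g z) : f = g := by
  refine AffineMap.ext_on (s := range hT.basis) hT.basis.tot ?_
  rw [hT.range_basis]
  exact fun z hz => h z hz

end IsSimplex

theorem isCompact_convexHull_finset (T : Finset (Euc d)) :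
    IsCompact (convexHull ℝ (T : Set (Euc d))) := T.finite_toSet.isCompact_convexHull ℝ

theorem measurableSet_convexHull_finset (T : Finset (Euc d)) :
    MeasurableSet (convexHull ℝ (T : Set (Euc d))) :=
  (isCompact_convexHull_finset T).isClosed.measurableSet

theorem interior_convexHull_ae_eq (T : Finset (Euc d)) :
    interior (convexHull ℝ (T : Set (Euc d))) =ᵐ[volume] convexHull ℝ (T : Set (Euc d)) :=
  interior_ae_eq_of_null_frontier ((convex_convexHull ℝ _).addHaar_frontier volume)

/-- At most `d` points span a proper affine subspace. -/
theorem volume_convexHull_eq_zero {F : Finset (Euc d)} (hF : F.card ≤ d) :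
    volume (convexHull ℝ (F : Set (Euc d))) = 0 := by
  refine measure_mono_null (convexHull_subset_affineSpan _)
    (Measure.addHaar_affineSubspace _ _ fun h => ?_)
  rcases F.eq_empty_or_nonempty with rfl | hne
  · simp at h
  have h2 : Module.finrank ℝ (vectorSpan ℝ (F : Set (Euc d))) = d := by
    rw [← direction_affineSpan, h, AffineSubspace.direction_top, finrank_top]
    simp
  have hpos := hne.card_pos
  have h3 := finrank_vectorSpan_range_le ℝ ((↑) : F → Euc d) (n := F.card - 1)
    (by rw [Fintype.card_coe]; omega)
  rw [Subtype.range_coe_subtype] at h3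
  change Module.finrank ℝ (vectorSpan ℝ (F : Set (Euc d))) ≤ _ at h3
  omega

/-- The space of parameters of the cone over the face with vertex set `F`. -/
abbrev ConeParam (F : Finset (Euc d)) : Type := PiLp 1 (fun _ : F => ℝ)

/-- The reason for the `ℓ¹` norm: in the positive orthant its unit sphere consists of barycentric
weights, i.e. it is the open face, and its unit ball is the open simplex over that face. -/
theorem ConeParam.norm_eq {F : Finset (Euc d)} {x : ConeParam F} (hx : ∀ i, 0 < x i) :
    ‖x‖ = ∑ i, x i := by
  rw [PiLp.norm_eq_of_nat 1 (by simp)]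
  simp only [pow_one, Nat.cast_one, div_one, Real.rpow_one]
  exact Finset.sum_congr rfl fun i _ => by rw [Real.norm_eq_abs, abs_of_pos (hx i)]

/-- The open positive orthant. -/
def orthant (F : Finset (Euc d)) : Set (ConeParam F) := {x | ∀ i, 0 < x i}

theorem measurableSet_orthant (F : Finset (Euc d)) : MeasurableSet (orthant F) := by
  have : orthant F = ⋂ i, {x : ConeParam F | 0 < x i} := by ext; simp [orthant]
  rw [this]
  exact MeasurableSet.iInter fun i =>
    (isOpen_lt continuous_const (PiLp.continuous_apply 1 _ i)).measurableSet

/-- The mean value of `φ` over the face with vertex set `F`. -/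
def faceMean (F : Finset (Euc d)) (φ : Euc d → ℝ) : ℝ :=
  (d * (Measure.addHaar (G := ConeParam F)).real (orthant F ∩ Metric.ball 0 1))⁻¹ *
    ∫ θ in {θ : Metric.sphere (0 : ConeParam F) 1 | (θ : ConeParam F) ∈ orthant F},
      φ (∑ i, θ.1 i • (i : Euc d)) ∂(Measure.addHaar (G := ConeParam F)).toSphere

theorem faceMean_eq_zero {F : Finset (Euc d)} {φ : Euc d → ℝ}
    (h : ∀ w : F → ℝ, (∀ i, 0 < w i) → ∑ i, w i = 1 → φ (∑ i, w i • (i : Euc d)) = 0) :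
    faceMean F φ = 0 := by
  rw [faceMean, setIntegral_eq_zero_of_forall_eq_zero, mul_zero]
  intro θ hθ
  refine h _ hθ ?_
  rw [← ConeParam.norm_eq hθ]
  simp

/-- The linear part of the parametrization of the simplex with base `F` and apex `z`. -/
def coneMap (F : Finset (Euc d)) (z : Euc d) : ConeParam F →ₗ[ℝ] Euc d where
  toFun x := ∑ i, x i • ((i : Euc d) - z)
  map_add' x y := by simp [add_smul, Finset.sum_add_distrib]
  map_smul' t x := by simp [Finset.smul_sum, smul_smul]

/-- Cone parameters are the barycentric coordinates of the base vertices. The remaining coordinate,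
that of the apex, is one minus their sum. -/
theorem bary_add_coneMap {T : Finset (Euc d)} (hT : IsSimplex T) {z : Euc d} (hz : z ∈ T)
    (f : (T.erase z : Finset (Euc d))) (x : ConeParam (T.erase z)) :
    bary T f (z + coneMap (T.erase z) z x) = x f := by
  have hf := f.2
  rw [Finset.mem_erase] at hf
  rw [add_comm, ← vadd_eq_add, AffineMap.map_vadd, hT.bary_of_ne hf.2 hz hf.1]
  simp only [coneMap, LinearMap.coe_mk, AddHom.coe_mk, map_sum, map_smul, vadd_eq_add, add_zero]
  rw [Finset.sum_eq_single f]
  · rw [← vsub_eq_sub, AffineMap.linearMap_vsub, hT.bary_self hf.2, hT.bary_of_ne hf.2 hz hf.1]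
    simp
  · intro b _ hb
    have hb2 := Finset.mem_erase.1 b.2
    rw [← vsub_eq_sub, AffineMap.linearMap_vsub, hT.bary_of_ne hf.2 hz hf.1,
      hT.bary_of_ne hf.2 hb2.2 (fun e => hb (Subtype.ext e.symm))]
    simp
  · simp

theorem coneMap_injective {T : Finset (Euc d)} (hT : IsSimplex T) {z : Euc d} (hz : z ∈ T) :
    Function.Injective (coneMap (T.erase z) z) := by
  intro x y h
  ext f
  rw [← bary_add_coneMap hT hz f x, h, bary_add_coneMap hT hz f y]

theorem finrank_coneParam {T : Finset (Euc d)} (hT : IsSimplex T) {z : Euc d} (hz : z ∈ T) :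
    Module.finrank ℝ (ConeParam (T.erase z)) = d := by
  rw [LinearEquiv.finrank_eq (WithLp.linearEquiv 1 ℝ (↥(T.erase z) → ℝ))]
  simp [Finset.card_erase_of_mem hz, hT.1]

/-- The parametrization of a simplex by the cone over a face, as a linear equivalence. -/
def coneEquiv {T : Finset (Euc d)} (hT : IsSimplex T) {z : Euc d} (hz : z ∈ T) :
    ConeParam (T.erase z) ≃L[ℝ] Euc d :=
  (LinearEquiv.ofInjectiveOfFinrankEq (coneMap (T.erase z) z) (coneMap_injective hT hz)
    (by rw [finrank_coneParam hT hz]; simp)).toContinuousLinearEquiv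

theorem coneEquiv_apply {T : Finset (Euc d)} (hT : IsSimplex T) {z : Euc d} (hz : z ∈ T)
    (x : ConeParam (T.erase z)) : coneEquiv hT hz x = coneMap (T.erase z) z x := rfl

theorem mem_interior_iff_coneEquiv {T : Finset (Euc d)} (hT : IsSimplex T) {z : Euc d}
    (hz : z ∈ T) (x : ConeParam (T.erase z)) :
    z + coneEquiv hT hz x ∈ interior (convexHull ℝ (T : Set (Euc d))) ↔
      x ∈ orthant (T.erase z) ∩ Metric.ball 0 1 := by
  have h1 : ∑ f : (T.erase z : Finset (Euc d)), x f + bary T z (z + coneEquiv hT hz x) = 1 := by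
    rw [← hT.sum_bary (z + coneEquiv hT hz x), ← Finset.sum_erase_add _ _ hz,
      ← Finset.sum_coe_sort (T.erase z)]
    congr 1
    exact Finset.sum_congr rfl fun f _ => (bary_add_coneMap hT hz f x).symm
  rw [hT.mem_interior]
  constructor
  · intro h
    have h2 : x ∈ orthant (T.erase z) := fun f => by
      rw [← bary_add_coneMap hT hz f x]; exact h _ (Finset.mem_of_mem_erase f.2)
    refine ⟨h2, ?_⟩
    rw [mem_ball_zero_iff, ConeParam.norm_eq h2]
    linarith [h z hz]
  · rintro ⟨h2, h3⟩ w hw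
    rw [mem_ball_zero_iff, ConeParam.norm_eq h2] at h3
    by_cases hwz : w = z
    · subst hwz; linarith
    · rw [coneEquiv_apply, bary_add_coneMap hT hz ⟨w, Finset.mem_erase.2 ⟨hwz, hw⟩⟩ x]
      exact h2 _

/-- By uniqueness of Haar measure, Lebesgue measure is a multiple of the image of the Haar measure
on the parameters. The factor is never computed: it is eliminated by taking `h = 1`. -/
theorem exists_integral_simplex_eq {T : Finset (Euc d)} (hT : IsSimplex T) {z : Euc d}
    (hz : z ∈ T) : ∃ c : ℝ, ∀ h : Euc d → ℝ,
      ∫ x in convexHull ℝ (T : Set (Euc d)), h x = c *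
        ∫ y in orthant (T.erase z) ∩ Metric.ball 0 1, h (z + coneEquiv hT hz y)
          ∂(Measure.addHaar (G := ConeParam (T.erase z))) := by
  set ν := Measure.addHaar (G := ConeParam (T.erase z))
  set L := coneEquiv hT hz
  have key := Measure.isAddLeftInvariant_eq_smul (volume : Measure (Euc d)) (ν.map L)
  refine ⟨(Measure.addHaarScalarFactor (volume : Measure (Euc d)) (ν.map L) : ℝ), fun h => ?_⟩
  have hμ : ∀ f : Euc d → ℝ, ∫ x, f x = ∫ x, f x ∂(
      Measure.addHaarScalarFactor (volume : Measure (Euc d)) (ν.map L) • ν.map L) :=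
    fun f => congrArg (fun μ => ∫ x, f x ∂μ) key
  have hm : MeasurableEmbedding L := L.toHomeomorph.measurableEmbedding
  rw [← setIntegral_congr_set (interior_convexHull_ae_eq T),
    ← integral_indicator isOpen_interior.measurableSet,
    ← integral_add_left_eq_self _ z, hμ, integral_smul_nnreal_measure,
    hm.integral_map, NNReal.smul_def, smul_eq_mul,
    ← integral_indicator ((measurableSet_orthant _).inter measurableSet_ball)]
  congr 2
  ext y
  by_cases hy : y ∈ orthant (T.erase z) ∩ Metric.ball 0 1
  · rw [indicator_of_mem hy, indicator_of_mem ((mem_interior_iff_coneEquiv hT hz y).2 hy)]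
  · rw [indicator_of_notMem hy,
      indicator_of_notMem (fun h' => hy ((mem_interior_iff_coneEquiv hT hz y).1 h'))]

/-- The divergence theorem for the field `x ↦ x - z` on a simplex with vertex `z`. -/
theorem integral_simplex_add_gradient (hd : 1 ≤ d) {T : Finset (Euc d)} (hT : IsSimplex T)
    {z : Euc d} (hz : z ∈ T) {φ : Euc d → ℝ} (hφ : ContDiff ℝ 1 φ) :
    ∫ x in convexHull ℝ (T : Set (Euc d)), (d * φ x + inner ℝ (x - z) (gradient φ x))
      = d * volume.real (convexHull ℝ (T : Set (Euc d))) * faceMean (T.erase z) φ := by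
  obtain ⟨c, hc⟩ := exists_integral_simplex_eq hT hz
  set ν := Measure.addHaar (G := ConeParam (T.erase z)) with hν
  set L := coneEquiv hT hz
  have hfr := finrank_coneParam hT hz
  have : Nontrivial (ConeParam (T.erase z)) :=
    Module.nontrivial_of_finrank_pos (R := ℝ) (by omega)
  have hvol : volume.real (convexHull ℝ (T : Set (Euc d))) =
      c * ν.real (orthant (T.erase z) ∩ Metric.ball 0 1) := by
    have := hc fun _ => 1
    simpa using this
  have hpos : volume.real (convexHull ℝ (T : Set (Euc d))) ≠ 0 := by
    refine (ENNReal.toReal_pos ?_ (isCompact_convexHull_finset T).measure_lt_top.ne).ne'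
    exact (Measure.measure_pos_of_nonempty_interior _ hT.nonempty_interior).ne'
  have hν0 : ν.real (orthant (T.erase z) ∩ Metric.ball 0 1) ≠ 0 := by
    intro h; rw [h, mul_zero] at hvol; exact hpos hvol
  have hg : ContDiff ℝ 1 (fun y => φ (z + L y)) :=
    hφ.comp (contDiff_const.add L.contDiff)
  have hcone := integral_cone_add_fderiv ν (measurableSet_orthant (T.erase z))
    (fun x t ht => by simp [orthant, ht]) hg
  rw [hc]
  have e1 : ∀ y, (d : ℝ) * φ (z + L y) + inner ℝ (z + L y - z) (gradient φ (z + L y)) =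
      (Module.finrank ℝ (ConeParam (T.erase z)) : ℝ) * φ (z + L y) +
        fderiv ℝ (fun y => φ (z + L y)) y y := by
    intro y
    have hφd := (hφ.differentiable (by norm_num)) (z + L y)
    have h1 : HasFDerivAt (fun y => φ (z + L y))
        ((fderiv ℝ φ (z + L y)).comp (L : ConeParam (T.erase z) →L[ℝ] Euc d)) y :=
      hφd.hasFDerivAt.comp y (L.hasFDerivAt.const_add z)
    rw [h1.fderiv, hfr, add_sub_cancel_left, real_inner_comm, ← InnerProductSpace.toDual_apply_apply (𝕜 := ℝ),
      toDual_gradient]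
    rfl
  simp only [e1]
  rw [hcone, hvol, faceMean]
  -- On the unit sphere the weights sum to one, so the apex `z` drops out and the integrand only
  -- involves the face.
  have e2 : ∀ θ : Metric.sphere (0 : ConeParam (T.erase z)) 1,
      (θ : ConeParam (T.erase z)) ∈ orthant (T.erase z) →
      φ (z + L θ) = φ (∑ i, θ.1 i • (i : Euc d)) := by
    intro θ hθ
    congr 1
    have : ∑ i, θ.1 i = 1 := by rw [← ConeParam.norm_eq hθ]; simp
    change z + ∑ i, θ.1 i • ((i : Euc d) - z) = _
    simp only [smul_sub, Finset.sum_sub_distrib, ← Finset.sum_smul, this, one_smul]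
    abel
  have e3 := setIntegral_congr_fun (μ := ν.toSphere)
    (measurable_subtype_coe (measurableSet_orthant (T.erase z))) e2
  rw [preimage] at e3
  rw [e3, ← hν]
  have hd0 : (d : ℝ) ≠ 0 := by positivity
  field_simp

end Simplex

/-! ### Neighbouring simplices and shape estimates. -/

section SimplexGeometry

variable {d : ℕ}

/-- The volume of the simplex with vertex set `T`. -/
def simplexVol (T : Finset (Euc d)) : ℝ := volume.real (convexHull ℝ (T : Set (Euc d)))

theorem simplexVol_pos {T : Finset (Euc d)} (hT : IsSimplex T) : 0 < simplexVol T :=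
  ENNReal.toReal_pos (Measure.measure_pos_of_nonempty_interior _ hT.nonempty_interior).ne'
    (isCompact_convexHull_finset T).measure_lt_top.ne

/-- Both sides are affine, vanish on the common face and agree at `z'`. The factor `bary T z z'`
encodes the relative orientation and the volume ratio of the two simplices. -/
theorem bary_eq_mul_bary {T T' : Finset (Euc d)} (hT : IsSimplex T) (hT' : IsSimplex T')
    {z z' : Euc d} (hz : z ∈ T) (hz' : z' ∈ T') (h : T.erase z = T'.erase z') (x : Euc d) :
    bary T z x = bary T z z' * bary T' z' x := by
  have key : bary T z = (bary T z z') • bary T' z' := by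
    refine hT'.bary_eq_of_eqOn fun w hw => ?_
    change bary T z w = bary T z z' * bary T' z' w
    by_cases hwz : w = z'
    · subst hwz
      rw [hT'.bary_self hz', mul_one]
    · rw [hT'.bary_of_ne hz' hw (Ne.symm hwz), mul_zero]
      have hw' : w ∈ T.erase z := h ▸ Finset.mem_erase.2 ⟨hwz, hw⟩
      exact hT.bary_of_ne hz (Finset.mem_of_mem_erase hw') (Finset.ne_of_mem_erase hw').symm
  conv_lhs => rw [key]
  rfl

/-- The affine map `x ↦ x + bary T z x • (z' - z)` fixes the common face and sends `z` to `z'`. Its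
linear part is a transvection of determinant `bary T z z'`. -/
theorem simplexVol_eq_abs_bary_mul {T T' : Finset (Euc d)} (hT : IsSimplex T)
    {z z' : Euc d} (hz : z ∈ T) (hz' : z' ∈ T')
    (h : T.erase z = T'.erase z') : simplexVol T' = |bary T z z'| * simplexVol T := by
  let A : Euc d →ₗ[ℝ] Euc d := LinearMap.transvection (bary T z).linear (z' - z)
  have hA : ∀ x, A x = x + (bary T z).linear x • (z' - z) := fun x => rfl
  let S : Euc d →ᵃ[ℝ] Euc d := A.toAffineMap + AffineMap.const ℝ (Euc d) (bary T z 0 • (z' - z))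
  have hlin : ∀ x, bary T z x = (bary T z).linear x + bary T z 0 := fun x => by
    have := (bary T z).map_vadd 0 x
    simpa using this
  have hS : ∀ x, S x = x + bary T z x • (z' - z) := fun x => by
    rw [hlin x, add_smul, ← add_assoc, ← hA]
    rfl
  have himg : S '' (T : Set (Euc d)) = T' := by
    have h1 : ∀ w ∈ T.erase z, S w = w := fun w hw => by
      rw [hS, hT.bary_of_ne hz (Finset.mem_of_mem_erase hw) (Finset.ne_of_mem_erase hw).symm]
      simp
    have h2 : S z = z' := by rw [hS, hT.bary_self hz]; simp
    rw [← Finset.insert_erase hz, ← Finset.insert_erase hz', ← h, Finset.coe_insert,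
      Finset.coe_insert, image_insert_eq, h2]
    congr 1
    exact (image_congr fun w hw => h1 w hw).trans (image_id _)
  have hdet : LinearMap.det A = bary T z z' := by
    rw [LinearMap.transvection.det, ← vsub_eq_sub, AffineMap.linearMap_vsub, hT.bary_self hz]
    simp
  rw [simplexVol, simplexVol, ← himg, ← AffineMap.image_convexHull]
  have himg2 : S '' convexHull ℝ (T : Set (Euc d)) =
      (fun x => x + bary T z 0 • (z' - z)) '' (A '' convexHull ℝ (T : Set (Euc d))) := by
    rw [image_image]; rfl
  rw [himg2, Measure.real, Measure.real, image_add_right, measure_preimage_add_right,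
    Measure.addHaar_image_linearMap, hdet, ENNReal.toReal_mul, ENNReal.toReal_ofReal (abs_nonneg _)]

/-- Two simplices with a common face which meet only in this face lie on opposite sides of it. -/
theorem bary_neg_of_inter_subset (hd : 1 ≤ d) {T T' : Finset (Euc d)} (hT : IsSimplex T)
    (hT' : IsSimplex T') {z z' : Euc d} (hz : z ∈ T) (hz' : z' ∈ T')
    (h : T.erase z = T'.erase z') (hne : T ≠ T')
    (hi : convexHull ℝ (T : Set (Euc d)) ∩ convexHull ℝ (T' : Set (Euc d)) ⊆
      convexHull ℝ ((T : Set (Euc d)) ∩ T')) : bary T z z' < 0 := by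
  -- Were `z'` on the same side as `z`, the barycenter of the face, moved slightly towards `z'`,
  -- would lie in both simplices but off the face. The value zero is impossible, since then `bary T
  -- z` would vanish at `z`.
  by_contra! hcon
  have hpos : 0 < bary T z z' := by
    refine lt_of_le_of_ne hcon fun h0 => ?_
    have := bary_eq_mul_bary hT hT' hz hz' h z
    rw [hT.bary_self hz, ← h0, zero_mul] at this
    exact one_ne_zero this
  have hF : (T : Set (Euc d)) ∩ T' = (T.erase z : Finset (Euc d)) := by
    ext w
    simp only [mem_inter_iff, Finset.mem_coe]
    constructor
    · rintro ⟨h1, h2⟩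
      refine Finset.mem_erase.2 ⟨?_, h1⟩
      rintro rfl
      by_cases hw : w = z'
      · subst hw
        exact hne (by rw [← Finset.insert_erase hz, h, Finset.insert_erase hz'])
      · have : w ∈ T.erase w := h ▸ Finset.mem_erase.2 ⟨hw, h2⟩
        exact Finset.notMem_erase _ _ this
    · intro hw
      exact ⟨Finset.mem_of_mem_erase hw, Finset.mem_of_mem_erase (h ▸ hw)⟩
  have hcard : (T.erase z).card = d := by rw [Finset.card_erase_of_mem hz, hT.1]; rfl
  have hne' : (T.erase z).Nonempty := Finset.card_pos.1 (by omega)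
  -- the barycenter of the face
  set b : Euc d := ∑ w ∈ T.erase z, (d : ℝ)⁻¹ • w with hb
  have hd0 : (0 : ℝ) < d := by positivity
  have hw1 : ∑ w ∈ T.erase z, (d : ℝ)⁻¹ = 1 := by
    rw [Finset.sum_const, hcard, nsmul_eq_mul, mul_inv_cancel₀ hd0.ne']
  have haff : ∀ f : Euc d →ᵃ[ℝ] ℝ, f b = ∑ w ∈ T.erase z, (d : ℝ)⁻¹ * f w := fun f => by
    have h1 : ∀ x, f x = f.linear x + f 0 := fun x => by simpa using f.map_vadd 0 x
    rw [h1, hb, map_sum]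
    simp only [map_smul, smul_eq_mul]
    have h2 : ∀ w ∈ T.erase z, (d : ℝ)⁻¹ * f w = (d : ℝ)⁻¹ * f.linear w + (d : ℝ)⁻¹ * f 0 :=
      fun w _ => by rw [h1 w, mul_add]
    rw [Finset.sum_congr rfl h2, Finset.sum_add_distrib, ← Finset.sum_mul, hw1, one_mul]
  have hbz : bary T z b = 0 := by
    rw [haff]
    refine Finset.sum_eq_zero fun w hw => ?_
    rw [hT.bary_of_ne hz (Finset.mem_of_mem_erase hw) (Finset.ne_of_mem_erase hw).symm, mul_zero]
  have hbw : ∀ w ∈ T.erase z, 0 < bary T w b := fun w hw => by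
    have hwT := Finset.mem_of_mem_erase hw
    rw [haff, Finset.sum_eq_single w]
    · rw [hT.bary_self hwT]; positivity
    · intro v hv hvw
      rw [hT.bary_of_ne hwT (Finset.mem_of_mem_erase hv) hvw.symm, mul_zero]
    · exact fun h => absurd hw h
  have hbT' : b ∈ convexHull ℝ (T' : Set (Euc d)) := by
    rw [hb]
    exact (convex_convexHull ℝ _).sum_mem (fun _ _ => by positivity) hw1
      fun w hw => subset_convexHull ℝ _ (Finset.mem_of_mem_erase (h ▸ hw))
  have hz'T' : z' ∈ convexHull ℝ (T' : Set (Euc d)) := subset_convexHull ℝ _ hz'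
  have hlm : ∀ (f : Euc d →ᵃ[ℝ] ℝ) (t : ℝ),
      f (AffineMap.lineMap b z' t) = (1 - t) * f b + t * f z' := by
    intro f t
    rw [AffineMap.apply_lineMap, AffineMap.lineMap_apply_module]; rfl
  have hev : ∀ᶠ t in nhdsWithin (0 : ℝ) (Ioi 0), ∀ w ∈ T.erase z,
      0 < (1 - t) * bary T w b + t * bary T w z' := by
    rw [Filter.eventually_all_finset]
    intro w hw
    have hc : Filter.Tendsto (fun t : ℝ => (1 - t) * bary T w b + t * bary T w z')
        (nhdsWithin 0 (Ioi 0)) (nhds ((1 - 0) * bary T w b + 0 * bary T w z')) := by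
      refine (Continuous.tendsto ?_ 0).mono_left nhdsWithin_le_nhds
      fun_prop
    exact hc.eventually_const_lt (by simpa using hbw w hw)
  obtain ⟨t, ht, ht0, ht1⟩ := (hev.and (Ioo_mem_nhdsGT (zero_lt_one (α := ℝ)))).exists
  have hxT' : AffineMap.lineMap b z' t ∈ convexHull ℝ (T' : Set (Euc d)) :=
    (convex_convexHull ℝ _).lineMap_mem hbT' hz'T' ⟨ht0.le, ht1.le⟩
  have hxz : bary T z (AffineMap.lineMap b z' t) = t * bary T z z' := by rw [hlm, hbz]; ring
  have hxT : AffineMap.lineMap b z' t ∈ convexHull ℝ (T : Set (Euc d)) := by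
    rw [hT.mem_convexHull]
    intro w hw
    by_cases hwz : w = z
    · subst hwz; rw [hxz]; positivity
    · rw [hlm]; exact (ht w (Finset.mem_erase.2 ⟨hwz, hw⟩)).le
  have hx := hi ⟨hxT, hxT'⟩
  rw [hF] at hx
  have hsub : convexHull ℝ ((T.erase z : Finset (Euc d)) : Set (Euc d)) ⊆ {x | bary T z x = 0} := by
    refine convexHull_min (fun w hw => ?_) ?_
    · exact hT.bary_of_ne hz (Finset.mem_of_mem_erase hw) (Finset.ne_of_mem_erase hw).symm
    · exact (convex_singleton (0 : ℝ)).affine_preimage (bary T z)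
  have := hsub hx
  rw [mem_ofPred_eq, hxz] at this
  exact (mul_pos ht0 hpos).ne' this

/-- A barycentric coordinate varies between 0 and 1 on a ball of diameter `2 * r`, so its gradient
is at most `1 / (2 * r)`. -/
theorem abs_linear_bary_mul_le {T : Finset (Euc d)} (hT : IsSimplex T) {z : Euc d} (hz : z ∈ T)
    {c : Euc d} {r : ℝ} (hr : 0 < r)
    (hball : Metric.closedBall c r ⊆ convexHull ℝ (T : Set (Euc d))) (v : Euc d) :
    |(bary T z).linear v| * (2 * r) ≤ ‖v‖ := by
  have key : ∀ v : Euc d, (bary T z).linear v * (2 * r) ≤ ‖v‖ := by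
    intro v
    rcases eq_or_ne v 0 with rfl | hv
    · simp
    have hv0 : 0 < ‖v‖ := norm_pos_iff.2 hv
    set u : Euc d := (r / ‖v‖) • v with hu
    have hun : ‖u‖ = r := by
      rw [hu, norm_smul, Real.norm_eq_abs, abs_of_pos (by positivity)]; field_simp
    have h1 : c + u ∈ convexHull ℝ (T : Set (Euc d)) := hball (by simp [hun])
    have h2 : c - u ∈ convexHull ℝ (T : Set (Euc d)) := hball (by simp [hun])
    have h3 : bary T z (c + u) ≤ 1 := by
      rw [← hT.sum_bary (c + u)]
      exact Finset.single_le_sum (f := fun z => bary T z (c + u))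
        (fun w hw => hT.mem_convexHull.1 h1 w hw) hz
    have h4 := hT.mem_convexHull.1 h2 z hz
    have h5 : (bary T z).linear ((c + u) - (c - u)) = bary T z (c + u) - bary T z (c - u) := by
      rw [← vsub_eq_sub (c + u), AffineMap.linearMap_vsub]; rfl
    have h6 : (c + u) - (c - u) = (2 * r / ‖v‖) • v := by
      rw [hu, mul_div_assoc, mul_smul, two_smul]; abel
    rw [h6, map_smul, smul_eq_mul] at h5
    have h7 : 2 * r / ‖v‖ * (bary T z).linear v ≤ 1 := by linarith
    rw [div_mul_eq_mul_div, div_le_one hv0] at h7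
    linarith
  rcases abs_cases ((bary T z).linear v) with ⟨h, -⟩ | ⟨h, -⟩ <;> rw [h]
  · exact key v
  · have := key (-v)
    rwa [map_neg, norm_neg] at this

theorem two_mul_radius_le_dist {T : Finset (Euc d)} (hT : IsSimplex T) {z w : Euc d} (hz : z ∈ T)
    (hw : w ∈ T) (hzw : z ≠ w) {c : Euc d} {r : ℝ} (hr : 0 < r)
    (hball : Metric.closedBall c r ⊆ convexHull ℝ (T : Set (Euc d))) : 2 * r ≤ dist z w := by
  have := abs_linear_bary_mul_le hT hz hr hball (z - w)
  rw [← vsub_eq_sub, AffineMap.linearMap_vsub, hT.bary_self hz, hT.bary_of_ne hz hw hzw] at this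
  simpa [dist_eq_norm] using this

/-- The coordinate of `z` vanishes at `w`, so its value at the origin is controlled by its gradient
and `‖w‖`. -/
theorem abs_bary_zero_mul_le {T : Finset (Euc d)} (hT : IsSimplex T) {z w : Euc d} (hz : z ∈ T)
    (hw : w ∈ T) (hzw : z ≠ w) {c : Euc d} {r : ℝ} (hr : 0 < r)
    (hball : Metric.closedBall c r ⊆ convexHull ℝ (T : Set (Euc d))) :
    |bary T z 0| * (2 * r) ≤ ‖w‖ := by
  have := abs_linear_bary_mul_le hT hz hr hball (0 - w)
  rw [← vsub_eq_sub, AffineMap.linearMap_vsub, hT.bary_of_ne hz hw hzw] at this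
  simpa using this

end SimplexGeometry

-- Locally the boundary lies in the graph of `γ` over the hyperplane orthogonal to `e`. The
-- translates of this graph by `e / (n + 1)` are pairwise disjoint and the translation vectors are
-- bounded, which forces measure zero.
open scoped Pointwise in
theorem HasLipschitzBoundary.volume_frontier {d : ℕ} {Ω : Set (Euc d)} (hΩl : HasLipschitzBoundary Ω)
    (hΩo : IsOpen Ω) : volume (frontier Ω) = 0 := by
  refine measure_null_of_locally_null _ fun x hx => ?_
  obtain ⟨e, r, K, γ, he, hr, hγ, h⟩ := hΩl x hx
  refine ⟨frontier Ω ∩ Metric.ball x r, Filter.inter_mem self_mem_nhdsWithin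
    (mem_nhdsWithin_of_mem_nhds (Metric.ball_mem_nhds x hr)), ?_⟩
  have hγc := hγ.continuous
  have hee : inner ℝ e e = (1 : ℝ) := by rw [real_inner_self_eq_norm_sq, he]; norm_num
  set G : Set (Euc d) := {y | γ (y - inner ℝ e y • e) = inner ℝ e y} with hG
  have hsub : frontier Ω ∩ Metric.ball x r ⊆ G := by
    rintro y ⟨hy, hyr⟩
    have hyΩ : y ∉ Ω := fun hy' => by
      rw [frontier, hΩo.interior_eq] at hy; exact hy.2 hy'
    have h1 : inner ℝ e y ≤ γ (y - inner ℝ e y • e) := not_lt.1 fun h' => hyΩ ((h y hyr).2 h')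
    refine le_antisymm (not_lt.1 fun h2 => ?_) h1
    have hopen : IsOpen {y : Euc d | inner ℝ e y < γ (y - inner ℝ e y • e)} :=
      isOpen_lt (by fun_prop) (by fun_prop)
    obtain ⟨w, ⟨hw1, hw2⟩, hw3⟩ := mem_closure_iff.1 (frontier_subset_closure hy) _
      (hopen.inter Metric.isOpen_ball) ⟨h2, hyr⟩
    exact lt_asymm hw1 ((h w hw2).1 hw3)
  refine measure_mono_null hsub ?_
  have hGm : MeasurableSet G := (isClosed_eq (by fun_prop) (by fun_prop)).measurableSet
  refine Measure.addHaar_eq_zero_of_disjoint_translates volume (fun n : ℕ => (1 / ((n : ℝ) + 1)) • e)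
    ?_ ?_ hGm
  · refine (Metric.isBounded_closedBall (x := (0 : Euc d)) (r := 1)).subset ?_
    rintro _ ⟨n, rfl⟩
    have : (1 : ℝ) / (n + 1) ≤ 1 := by
      rw [div_le_one (by positivity)]; linarith [(Nat.cast_nonneg n : (0 : ℝ) ≤ n)]
    have h0 : (0 : ℝ) ≤ 1 / (n + 1) := by positivity
    rw [mem_closedBall_zero_iff, norm_smul, he, mul_one, Real.norm_eq_abs, abs_of_nonneg h0]
    exact this
  · intro m n hmn
    rw [Function.onFun, disjoint_left]
    rintro y hy1 hy2
    have key : ∀ k : ℕ, y ∈ ({(1 / ((k : ℝ) + 1)) • e} : Set (Euc d)) + G →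
        γ (y - inner ℝ e y • e) = inner ℝ e y - 1 / ((k : ℝ) + 1) := by
      rintro k hk
      obtain ⟨a, ha, g, hg, rfl⟩ := Set.mem_add.1 hk
      rw [mem_singleton_iff] at ha
      subst ha
      have hg' : γ (g - inner ℝ e g • e) = inner ℝ e g := hg
      rw [inner_add_right, inner_smul_right, hee, mul_one, add_smul, add_sub_add_left_eq_sub, hg']
      ring
    have := (key m hy1).symm.trans (key n hy2)
    have h2 : (1 : ℝ) / (m + 1) = 1 / (n + 1) := by linarith
    have h3 : ((m : ℝ) + 1) = n + 1 := by
      have := congrArg (fun t : ℝ => t⁻¹) h2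
      simpa using this
    exact hmn (by exact_mod_cast add_right_cancel h3)

/-! ### Cells and faces of a conforming mesh. -/

namespace SimplicialMesh

variable {d : ℕ} {Ω : Set (Euc d)}

theorem isSimplex (M : SimplicialMesh Ω) {T : Finset (Euc d)} (hT : T ∈ M.cells) : IsSimplex T :=
  ⟨M.card_eq T hT, M.affineIndependent T hT⟩

theorem convexHull_subset (M : SimplicialMesh Ω) {T : Finset (Euc d)} (hT : T ∈ M.cells) :
    convexHull ℝ (T : Set (Euc d)) ⊆ closure Ω := by
  rw [← M.cover]
  exact subset_biUnion_of_mem (u := fun T : Finset (Euc d) => convexHull ℝ (T : Set (Euc d))) hT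

/-- By conformity the intersection lies in the hull of the common vertices, and distinct cells share
at most `d` of them. -/
theorem volume_inter_eq_zero (M : SimplicialMesh Ω) {S T : Finset (Euc d)} (hS : S ∈ M.cells)
    (hT : T ∈ M.cells) (hST : S ≠ T) :
    volume (convexHull ℝ (S : Set (Euc d)) ∩ convexHull ℝ (T : Set (Euc d))) = 0 := by
  classical
  refine measure_mono_null (M.inter_subset S hS T hT) ?_
  rw [← Finset.coe_inter]
  refine volume_convexHull_eq_zero ?_
  by_contra! h
  have h1 := Finset.eq_of_subset_of_card_le (Finset.inter_subset_left (s₁ := S) (s₂ := T))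
    (by rw [M.card_eq S hS]; exact h)
  have h2 := Finset.eq_of_subset_of_card_le (Finset.inter_subset_right (s₁ := S) (s₂ := T))
    (by rw [M.card_eq T hT]; exact h)
  exact hST (h1.symm.trans h2)

theorem restrict_le_of_mem (M : SimplicialMesh Ω) (h0 : volume (frontier Ω) = 0)
    {T : Finset (Euc d)} (hT : T ∈ M.cells) :
    (volume.restrict (convexHull ℝ (T : Set (Euc d)))) ≤ volume.restrict Ω := by
  rw [Measure.restrict_congr_set (closure_ae_eq_of_null_frontier h0).symm]
  exact Measure.restrict_mono (M.convexHull_subset hT) le_rfl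

/-- The cells cover the closure of `Ω`, not `Ω` itself; a null boundary makes the difference
harmless. -/
theorem integral_eq_sum (M : SimplicialMesh Ω) (h0 : volume (frontier Ω) = 0) {h : Euc d → ℝ}
    (hh : ∀ T ∈ M.cells, IntegrableOn h (convexHull ℝ (T : Set (Euc d)))) :
    ∫ x in Ω, h x = ∑ T ∈ M.cells, ∫ x in convexHull ℝ (T : Set (Euc d)), h x := by
  have hcov : ⋃ T ∈ M.cells, convexHull ℝ (T : Set (Euc d)) =
      ⋃ T : M.cells, convexHull ℝ ((T : Finset (Euc d)) : Set (Euc d)) := by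
    ext; simp
  have hd : Pairwise (Function.onFun (AEDisjoint volume)
      fun T : M.cells => convexHull ℝ ((T : Finset (Euc d)) : Set (Euc d))) :=
    fun S T hST => M.volume_inter_eq_zero S.2 T.2 fun h => hST (Subtype.ext h)
  have hm : ∀ T : M.cells, NullMeasurableSet (convexHull ℝ ((T : Finset (Euc d)) : Set (Euc d)))
      volume := fun T => (measurableSet_convexHull_finset _).nullMeasurableSet
  rw [setIntegral_congr_set (closure_ae_eq_of_null_frontier h0).symm, ← M.cover, hcov,
    integral_iUnion_ae hm hd, tsum_fintype,
    Finset.sum_coe_sort M.cells fun T => ∫ x in convexHull ℝ (T : Set (Euc d)), h x]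
  rw [integrableOn_finite_iUnion]
  exact fun T => hh T T.2

theorem sum_indicator_ae_eq {B : Type*} [AddCommMonoid B] (M : SimplicialMesh Ω)
    (f : Finset (Euc d) → Euc d → B) {T : Finset (Euc d)} (hT : T ∈ M.cells) :
    (fun x => ∑ S ∈ M.cells, (convexHull ℝ (S : Set (Euc d))).indicator (f S) x)
      =ᵐ[volume.restrict (convexHull ℝ (T : Set (Euc d)))] f T := by
  have h1 : ∀ᵐ x ∂(volume.restrict (convexHull ℝ (T : Set (Euc d)))),
      ∀ S ∈ M.cells, S ≠ T → x ∉ convexHull ℝ (S : Set (Euc d)) := by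
    rw [Filter.eventually_all_finset]
    intro S hS
    by_cases hST : S = T
    · simp [hST]
    rw [ae_restrict_iff' (measurableSet_convexHull_finset T)]
    filter_upwards [compl_mem_ae_iff.2 (M.volume_inter_eq_zero hS hT hST)] with x hx hxT _ hxS
    exact hx ⟨hxS, hxT⟩
  filter_upwards [h1, ae_restrict_mem (measurableSet_convexHull_finset T)] with x hx hxT
  rw [Finset.sum_eq_single T (fun S hS hST => indicator_of_notMem (hx S hS hST) _)
    (fun h => absurd hT h), indicator_of_mem hxT]

theorem memLp_sum_indicator {B : Type*} [NormedAddCommGroup B] (M : SimplicialMesh Ω)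
    {f : Finset (Euc d) → Euc d → B} (hf : ∀ T ∈ M.cells, Continuous (f T)) :
    MemLp (fun x => ∑ S ∈ M.cells, (convexHull ℝ (S : Set (Euc d))).indicator (f S) x) 2
      (volume.restrict Ω) := by
  refine MemLp.restrict _ (memLp_finsetSum _ fun S hS => ?_)
  rw [memLp_indicator_iff_restrict (measurableSet_convexHull_finset S)]
  have : IsFiniteMeasure (volume.restrict (convexHull ℝ (S : Set (Euc d)))) :=
    ⟨by simpa using (isCompact_convexHull_finset S).measure_lt_top⟩
  obtain ⟨C, hC⟩ := (isCompact_convexHull_finset S).exists_bound_of_continuousOn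
    (hf S hS).continuousOn
  refine MemLp.of_bound ((hf S hS).continuousOn.aestronglyMeasurable_of_isCompact
    (isCompact_convexHull_finset S) (measurableSet_convexHull_finset S)) C ?_
  filter_upwards [ae_restrict_mem (measurableSet_convexHull_finset S)] with x hx using hC x hx

/-- The pairs of a cell and one of its vertices. -/
def pairs (M : SimplicialMesh Ω) : Finset (Σ _ : Finset (Euc d), Euc d) := M.cells.sigma fun T => T

/-- The face of a cell opposite to one of its vertices. -/
def face (q : Σ _ : Finset (Euc d), Euc d) : Finset (Euc d) := q.1.erase q.2

open Classical in
/-- The pairs which have a given face. -/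
def fiber (M : SimplicialMesh Ω) (F : Finset (Euc d)) : Finset (Σ _ : Finset (Euc d), Euc d) :=
  M.pairs.filter fun q => face q = F

theorem mem_pairs {M : SimplicialMesh Ω} {q : Σ _ : Finset (Euc d), Euc d} :
    q ∈ M.pairs ↔ q.1 ∈ M.cells ∧ q.2 ∈ q.1 := Finset.mem_sigma

theorem mem_fiber {M : SimplicialMesh Ω} {F : Finset (Euc d)} {q : Σ _ : Finset (Euc d), Euc d} :
    q ∈ M.fiber F ↔ q ∈ M.pairs ∧ face q = F := by simp [fiber]

theorem ne_fst_of_face_eq {M : SimplicialMesh Ω} {q q' : Σ _ : Finset (Euc d), Euc d}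
    (hq : q ∈ M.pairs) (hf : face q = face q') (hne : q ≠ q') : q.1 ≠ q'.1 := by
  obtain ⟨T, z⟩ := q
  obtain ⟨T', z'⟩ := q'
  rintro rfl
  have hz := (mem_pairs.1 hq).2
  by_cases h : z = z'
  · exact hne (by rw [h])
  · have : z ∈ T.erase z := by
      have : T.erase z = T.erase z' := hf
      rw [this]
      exact Finset.mem_erase.2 ⟨h, hz⟩
    exact Finset.notMem_erase _ _ this

theorem bary_neg (hd : 1 ≤ d) {M : SimplicialMesh Ω} {q q' : Σ _ : Finset (Euc d), Euc d}
    (hq : q ∈ M.pairs) (hq' : q' ∈ M.pairs) (hf : face q = face q') (hne : q ≠ q') :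
    bary q.1 q.2 q'.2 < 0 := by
  obtain ⟨h1, h2⟩ := mem_pairs.1 hq
  obtain ⟨h1', h2'⟩ := mem_pairs.1 hq'
  exact bary_neg_of_inter_subset hd (M.isSimplex h1) (M.isSimplex h1') h2 h2' hf
    (ne_fst_of_face_eq hq hf hne) (M.inter_subset _ h1 _ h1')

/-- A face belongs to at most two cells. -/
theorem fiber_cases (hd : 1 ≤ d) {M : SimplicialMesh Ω} {q : Σ _ : Finset (Euc d), Euc d}
    (hq : q ∈ M.pairs) : M.fiber (face q) = {q} ∨
      ∃ q' ∈ M.pairs, q ≠ q' ∧ face q = face q' ∧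
        ∀ f : (Σ _ : Finset (Euc d), Euc d) → ℝ, ∑ t ∈ M.fiber (face q), f t = f q + f q' := by
  classical
  by_cases h : ∃ q' ∈ M.pairs, q ≠ q' ∧ face q = face q'
  · obtain ⟨q', hq', hne, hf⟩ := h
    refine Or.inr ⟨q', hq', hne, hf, fun f => ?_⟩
    have : M.fiber (face q) = {q, q'} := by
      ext t
      rw [mem_fiber, Finset.mem_insert, Finset.mem_singleton]
      constructor
      · rintro ⟨ht, htf⟩
        -- With three cells on one face, each pair would lie on opposite sides of it, which
        -- contradicts the multiplicativity of the sign in `bary_eq_mul_bary`.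
        by_contra! hcon
        have h1 := bary_neg hd hq hq' hf hne
        have h2 := bary_neg hd hq ht htf.symm hcon.1.symm
        have h3 := bary_neg hd hq' ht (hf.symm.trans htf.symm) hcon.2.symm
        have h4 := bary_eq_mul_bary (M.isSimplex (mem_pairs.1 hq).1)
          (M.isSimplex (mem_pairs.1 hq').1) (mem_pairs.1 hq).2 (mem_pairs.1 hq').2 hf t.2
        nlinarith [mul_pos_of_neg_of_neg h1 h3]
      · rintro (rfl | rfl)
        · exact ⟨hq, rfl⟩
        · exact ⟨hq', hf.symm⟩
    rw [this, Finset.sum_pair hne]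
  · left
    push Not at h
    ext t
    rw [mem_fiber, Finset.mem_singleton]
    constructor
    · rintro ⟨ht, htf⟩
      by_contra hcon
      exact h t ht (Ne.symm hcon) htf.symm
    · rintro rfl
      exact ⟨hq, rfl⟩

theorem sum_pairs_eq_sum_fiber (M : SimplicialMesh Ω)
    (f : (Σ _ : Finset (Euc d), Euc d) → ℝ) :
    ∑ q ∈ M.pairs, f q = ∑ F ∈ M.pairs.image face, ∑ q ∈ M.fiber F, f q := by
  classical
  exact (Finset.sum_fiberwise_of_maps_to (fun q hq => Finset.mem_image_of_mem face hq) f).symm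

/-- A face which belongs to one cell only lies in the boundary. -/
theorem notMem_of_fiber_eq_singleton (hΩo : IsOpen Ω) {M : SimplicialMesh Ω}
    {q : Σ _ : Finset (Euc d), Euc d} (hq : q ∈ M.pairs) (hs : M.fiber (face q) = {q})
    (w : face q → ℝ) (hw : ∀ i, 0 < w i) (hw1 : ∑ i, w i = 1) :
    ∑ i, w i • (i : Euc d) ∉ Ω := by
  classical
  intro hx
  obtain ⟨T, z⟩ := q
  obtain ⟨hT, hz⟩ := mem_pairs.1 hq
  simp only at hT hz
  have hTs := M.isSimplex hT
  set x := ∑ i, w i • (i : Euc d) with hxdef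
  have haff : ∀ f : Euc d →ᵃ[ℝ] ℝ, f x = ∑ i, w i * f i := fun f => by
    have h1 : ∀ x, f x = f.linear x + f 0 := fun x => by simpa using f.map_vadd 0 x
    rw [h1, hxdef, map_sum]
    simp only [map_smul, smul_eq_mul]
    have h2 : ∀ i ∈ Finset.univ, w i * f i = w i * f.linear i + w i * f 0 :=
      fun i _ => by rw [h1 i, mul_add]
    rw [Finset.sum_congr rfl h2, Finset.sum_add_distrib, ← Finset.sum_mul, hw1, one_mul]
  have hmem : ∀ i : face ⟨T, z⟩, (i : Euc d) ∈ T ∧ (i : Euc d) ≠ z := fun i =>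
    ⟨Finset.mem_of_mem_erase i.2, Finset.ne_of_mem_erase i.2⟩
  have hxz : bary T z x = 0 := by
    rw [haff]
    exact Finset.sum_eq_zero fun i _ => by
      rw [hTs.bary_of_ne hz (hmem i).1 (hmem i).2.symm, mul_zero]
  have hxi : ∀ i : face ⟨T, z⟩, bary T i x = w i := fun i => by
    rw [haff, Finset.sum_eq_single i, hTs.bary_self (hmem i).1, mul_one]
    · intro j _ hj
      rw [hTs.bary_of_ne (hmem i).1 (hmem j).1 (fun h => hj (Subtype.ext h.symm)), mul_zero]
    · simp
  have hxT : x ∈ convexHull ℝ (T : Set (Euc d)) := by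
    rw [hTs.mem_convexHull]
    intro v hv
    by_cases hvz : v = z
    · rw [hvz, hxz]
    · rw [hxi ⟨v, Finset.mem_erase.2 ⟨hvz, hv⟩⟩]
      exact (hw _).le
  have hcl : IsClosed (⋃ S ∈ M.cells.erase T, convexHull ℝ (S : Set (Euc d))) :=
    isClosed_biUnion_finset fun S _ => (isCompact_convexHull_finset S).isClosed
  -- Points just beyond `x`, seen from `z`, have negative coordinate at `z` and so lie outside `T`.
  -- If `x ∈ Ω` they are covered by other cells, whose union is closed and therefore contains `x`.
  have htend : Filter.Tendsto (fun t : ℝ => AffineMap.lineMap x z (-t))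
      (nhdsWithin 0 (Ioi 0)) (nhds x) := by
    have : Continuous fun t : ℝ => AffineMap.lineMap x z (-t) := by
      simp only [AffineMap.lineMap_apply_module]; fun_prop
    have h2 := this.tendsto 0
    simp only [neg_zero, AffineMap.lineMap_apply_zero] at h2
    exact h2.mono_left nhdsWithin_le_nhds
  have hxS : x ∈ ⋃ S ∈ M.cells.erase T, convexHull ℝ (S : Set (Euc d)) := by
    refine hcl.mem_of_tendsto htend ?_
    filter_upwards [htend.eventually (hΩo.mem_nhds hx), self_mem_nhdsWithin] with t ht ht0
    have h1 := subset_closure ht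
    rw [← M.cover] at h1
    simp only [mem_iUnion] at h1 ⊢
    obtain ⟨S, hS, h2⟩ := h1
    refine ⟨S, Finset.mem_erase.2 ⟨?_, hS⟩, h2⟩
    rintro rfl
    have h3 := hTs.mem_convexHull.1 h2 z hz
    rw [AffineMap.apply_lineMap, hxz, hTs.bary_self hz, AffineMap.lineMap_apply_module] at h3
    simp at h3
    exact absurd ht0 (not_lt.2 h3)
  simp only [mem_iUnion] at hxS
  obtain ⟨S, hS, hxS⟩ := hxS
  obtain ⟨hST, hS⟩ := Finset.mem_erase.1 hS
  have hxi' := M.inter_subset T hT S hS ⟨hxT, hxS⟩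
  -- By conformity `x` lies in the hull of the common vertices. All weights of `x` on the face are
  -- positive, so every vertex of the face is common, and `S` is a second cell with this face.
  have hsub : T.erase z ⊆ S := by
    intro v hv
    by_contra hvS
    have hvT := Finset.mem_of_mem_erase hv
    have h1 : convexHull ℝ ((T : Set (Euc d)) ∩ S) ⊆ {y | bary T v y = 0} := by
      refine convexHull_min (fun u hu => ?_) ?_
      · exact hTs.bary_of_ne hvT hu.1 (fun h => hvS (by rw [h]; exact hu.2))
      · exact (convex_singleton (0 : ℝ)).affine_preimage (bary T v)
    have h2 : bary T v x = 0 := h1 hxi'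
    rw [hxi ⟨v, hv⟩] at h2
    exact (hw _).ne' h2
  have hcardF : (T.erase z).card = d := by rw [Finset.card_erase_of_mem hz, hTs.1]; rfl
  obtain ⟨z', hz'⟩ : ∃ z', S \ T.erase z = {z'} := by
    rw [← Finset.card_eq_one, Finset.card_sdiff_of_subset hsub, M.card_eq S hS, hcardF]
    omega
  have hz'S : z' ∈ S \ T.erase z := by rw [hz']; exact Finset.mem_singleton_self _
  have hface : S.erase z' = T.erase z := by
    rw [Finset.erase_eq, ← hz', Finset.sdiff_sdiff_eq_self hsub]
  have : (⟨S, z'⟩ : Σ _ : Finset (Euc d), Euc d) ∈ M.fiber (face ⟨T, z⟩) :=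
    mem_fiber.2 ⟨mem_pairs.2 ⟨hS, (Finset.mem_sdiff.1 hz'S).1⟩, hface⟩
  rw [hs, Finset.mem_singleton] at this
  exact hST (congrArg Sigma.fst this)

end SimplicialMesh

/-! ### Raviart-Thomas fields with prescribed face fluxes. -/

namespace SimplicialMesh

variable {d : ℕ} {Ω : Set (Euc d)}

/-- The lowest order Raviart-Thomas field on one cell with the given outward fluxes, where `α ⟨T, z⟩`
is the flux of `T` through the face opposite to `z`. -/
def rtLocal (α : (Σ _ : Finset (Euc d), Euc d) → ℝ) (T : Finset (Euc d)) (x : Euc d) : Euc d :=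
  ∑ z ∈ T, (α ⟨T, z⟩ / (d * simplexVol T)) • (x - z)

/-- The divergence of the Raviart-Thomas field on one cell. -/
def rtLocalDiv (α : (Σ _ : Finset (Euc d), Euc d) → ℝ) (T : Finset (Euc d)) : ℝ :=
  (∑ z ∈ T, α ⟨T, z⟩) / simplexVol T

/-- The Raviart-Thomas field with the given fluxes. -/
def rtField (M : SimplicialMesh Ω) (α : (Σ _ : Finset (Euc d), Euc d) → ℝ) (x : Euc d) : Euc d :=
  ∑ T ∈ M.cells, (convexHull ℝ (T : Set (Euc d))).indicator (rtLocal α T) x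

/-- The piecewise constant function with the given values. -/
def piecewiseConst (M : SimplicialMesh Ω) (p : Finset (Euc d) → ℝ) (x : Euc d) : ℝ :=
  ∑ T ∈ M.cells, (convexHull ℝ (T : Set (Euc d))).indicator (fun _ => p T) x

theorem continuous_rtLocal (α : (Σ _ : Finset (Euc d), Euc d) → ℝ) (T : Finset (Euc d)) :
    Continuous (rtLocal α T) := by
  unfold rtLocal; fun_prop

theorem memLp_rtField (M : SimplicialMesh Ω) (α : (Σ _ : Finset (Euc d), Euc d) → ℝ) :
    MemLp (M.rtField α) 2 (volume.restrict Ω) :=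
  M.memLp_sum_indicator fun T _ => continuous_rtLocal α T

theorem memLp_piecewiseConst (M : SimplicialMesh Ω) (p : Finset (Euc d) → ℝ) :
    MemLp (M.piecewiseConst p) 2 (volume.restrict Ω) :=
  M.memLp_sum_indicator fun _ _ => continuous_const

theorem rtField_ae_eq (M : SimplicialMesh Ω) (α : (Σ _ : Finset (Euc d), Euc d) → ℝ)
    {T : Finset (Euc d)} (hT : T ∈ M.cells) :
    M.rtField α =ᵐ[volume.restrict (convexHull ℝ (T : Set (Euc d)))] rtLocal α T :=
  M.sum_indicator_ae_eq (rtLocal α) hT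

theorem piecewiseConst_ae_eq (M : SimplicialMesh Ω) (p : Finset (Euc d) → ℝ)
    {T : Finset (Euc d)} (hT : T ∈ M.cells) :
    M.piecewiseConst p =ᵐ[volume.restrict (convexHull ℝ (T : Set (Euc d)))] fun _ => p T :=
  M.sum_indicator_ae_eq (fun T _ => p T) hT

/-- Fluxes which are opposite to each other on the two sides of each interior face. -/
def FluxAntisymm (M : SimplicialMesh Ω) (α : (Σ _ : Finset (Euc d), Euc d) → ℝ) : Prop :=
  ∀ q ∈ M.pairs, ∀ q' ∈ M.pairs, q ≠ q' → face q = face q' → α q' = -α q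

/-- On an interior face the two opposite fluxes meet the same mean and cancel. A face with a single
cell lies outside `Ω` up to its relative boundary, where `φ` vanishes, so its flux is unrestricted.
-/
theorem sum_flux_mul_faceMean_eq_zero (hd : 1 ≤ d) (hΩo : IsOpen Ω) (M : SimplicialMesh Ω)
    {α : (Σ _ : Finset (Euc d), Euc d) → ℝ} (hα : M.FluxAntisymm α) {φ : Euc d → ℝ}
    (hφ : ∀ x ∉ Ω, φ x = 0) : ∑ q ∈ M.pairs, α q * faceMean (face q) φ = 0 := by
  classical
  rw [M.sum_pairs_eq_sum_fiber]
  refine Finset.sum_eq_zero fun F hF => ?_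
  obtain ⟨q, hq, rfl⟩ := Finset.mem_image.1 hF
  rcases fiber_cases hd hq with h | ⟨q', hq', hne, hf, h⟩
  · rw [h, Finset.sum_singleton, faceMean_eq_zero, mul_zero]
    exact fun w hw hw1 => hφ _ (notMem_of_fiber_eq_singleton hΩo hq h w hw hw1)
  · rw [h, hα q hq q' hq' hne hf, ← hf]; ring

/-- Green's formula on one cell. The factor `1 / (d * simplexVol T)` in `rtLocal` is the one that
makes `x - z` have unit flux through the face opposite to `z`. -/
theorem integral_rtLocal_inner_gradient (hd : 1 ≤ d) (α : (Σ _ : Finset (Euc d), Euc d) → ℝ)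
    {T : Finset (Euc d)} (hT : IsSimplex T) {φ : Euc d → ℝ} (hφ : ContDiff ℝ 1 φ) :
    ∫ x in convexHull ℝ (T : Set (Euc d)), inner ℝ (rtLocal α T x) (gradient φ x) =
      ∑ z ∈ T, α ⟨T, z⟩ * faceMean (T.erase z) φ -
        ∫ x in convexHull ℝ (T : Set (Euc d)), rtLocalDiv α T * φ x := by
  have hgrad : Continuous (gradient φ) := by
    have := hφ.continuous_fderiv (by norm_num)
    exact (LinearIsometryEquiv.continuous _).comp this
  have hcont := hφ.continuous
  have hint : ∀ f : Euc d → ℝ, Continuous f → IntegrableOn f (convexHull ℝ (T : Set (Euc d))) :=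
    fun f hf => hf.continuousOn.integrableOn_compact (isCompact_convexHull_finset T)
  have hV := simplexVol_pos hT
  have hd0 : (0 : ℝ) < d := by positivity
  have h1 : ∀ z ∈ T, ∫ x in convexHull ℝ (T : Set (Euc d)), inner ℝ (x - z) (gradient φ x) =
      d * simplexVol T * faceMean (T.erase z) φ - d * ∫ x in convexHull ℝ (T : Set (Euc d)), φ x := by
    intro z hz
    have := integral_simplex_add_gradient hd hT hz hφ
    rw [integral_add (hint _ (by fun_prop)) (hint _ (by fun_prop)), integral_const_mul] at this
    rw [simplexVol]
    linarith
  simp only [rtLocal, sum_inner, inner_smul_left, RCLike.conj_to_real]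
  rw [integral_finsetSum _ fun z _ => hint _ (by fun_prop), integral_const_mul, rtLocalDiv,
    div_mul_eq_mul_div, Finset.sum_mul, Finset.sum_div, ← Finset.sum_sub_distrib]
  refine Finset.sum_congr rfl fun z hz => ?_
  rw [integral_const_mul, h1 z hz]
  field_simp

theorem hasWeakDiv_rtField (hd : 1 ≤ d) (hΩo : IsOpen Ω) (h0 : volume (frontier Ω) = 0)
    (M : SimplicialMesh Ω) {α : (Σ _ : Finset (Euc d), Euc d) → ℝ} (hα : M.FluxAntisymm α) :
    HasWeakDiv Ω (M.memLp_rtField α).toLp ((M.memLp_piecewiseConst (rtLocalDiv α)).toLp) := by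
  intro φ hφ hc hs
  have hφ1 : ContDiff ℝ 1 φ := hφ.of_le (by exact_mod_cast le_top)
  have hgrad : Continuous (gradient φ) := by
    have := hφ1.continuous_fderiv (by norm_num)
    exact (LinearIsometryEquiv.continuous _).comp this
  have hcont := hφ1.continuous
  have e1 : ∫ x in Ω, inner ℝ ((M.memLp_rtField α).toLp _ x) (gradient φ x) =
      ∫ x in Ω, inner ℝ (M.rtField α x) (gradient φ x) := by
    refine integral_congr_ae ?_
    filter_upwards [(M.memLp_rtField α).coeFn_toLp] with x hx
    rw [hx]
  have e2 : ∫ x in Ω, (M.memLp_piecewiseConst (rtLocalDiv α)).toLp _ x * φ x =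
      ∫ x in Ω, M.piecewiseConst (rtLocalDiv α) x * φ x := by
    refine integral_congr_ae ?_
    filter_upwards [(M.memLp_piecewiseConst (rtLocalDiv α)).coeFn_toLp] with x hx
    rw [hx]
  have a1 : ∀ T ∈ M.cells, (fun x => inner ℝ (M.rtField α x) (gradient φ x))
      =ᵐ[volume.restrict (convexHull ℝ (T : Set (Euc d)))]
        fun x => inner ℝ (rtLocal α T x) (gradient φ x) := by
    intro T hT
    filter_upwards [M.rtField_ae_eq α hT] with x hx
    rw [hx]
  have a2 : ∀ T ∈ M.cells, (fun x => M.piecewiseConst (rtLocalDiv α) x * φ x)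
      =ᵐ[volume.restrict (convexHull ℝ (T : Set (Euc d)))] fun x => rtLocalDiv α T * φ x := by
    intro T hT
    filter_upwards [M.piecewiseConst_ae_eq (rtLocalDiv α) hT] with x hx
    rw [hx]
  rw [e1, e2, M.integral_eq_sum h0, M.integral_eq_sum h0,
    Finset.sum_congr rfl fun T hT => integral_congr_ae (a1 T hT),
    Finset.sum_congr rfl fun T hT => integral_congr_ae (a2 T hT),
    Finset.sum_congr rfl fun T hT => integral_rtLocal_inner_gradient hd α (M.isSimplex hT) hφ1,
    Finset.sum_sub_distrib]
  · have := M.sum_flux_mul_faceMean_eq_zero hd hΩo hα (φ := φ)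
      fun x hx => image_eq_zero_of_notMem_tsupport fun h => hx (hs h)
    rw [pairs, Finset.sum_sigma] at this
    simp only [face] at this
    rw [this, zero_sub]
  · intro T hT
    refine IntegrableOn.congr_fun_ae ?_ (a2 T hT).symm
    exact (by fun_prop : Continuous fun x => rtLocalDiv α T * φ x).continuousOn.integrableOn_compact
      (isCompact_convexHull_finset T)
  · intro T hT
    refine IntegrableOn.congr_fun_ae ?_ (a1 T hT).symm
    have := continuous_rtLocal α T
    exact (by fun_prop : Continuous fun x => inner ℝ (rtLocal α T x)
      (gradient φ x)).continuousOn.integrableOn_compact (isCompact_convexHull_finset T)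

/-- The Raviart-Thomas field with the given fluxes, as an element of `H(div; Ω)`. -/
def rtHdiv (hd : 1 ≤ d) (hΩo : IsOpen Ω) (h0 : volume (frontier Ω) = 0)
    (M : SimplicialMesh Ω) {α : (Σ _ : Finset (Euc d), Euc d) → ℝ} (hα : M.FluxAntisymm α) :
    Hdiv Ω := ⟨(M.memLp_rtField α).toLp, _, M.hasWeakDiv_rtField hd hΩo h0 hα⟩

theorem div_rtHdiv (hd : 1 ≤ d) (hΩo : IsOpen Ω) (h0 : volume (frontier Ω) = 0)
    (M : SimplicialMesh Ω) {α : (Σ _ : Finset (Euc d), Euc d) → ℝ} (hα : M.FluxAntisymm α) :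
    (M.rtHdiv hd hΩo h0 hα).div = (M.memLp_piecewiseConst (rtLocalDiv α)).toLp :=
  Hdiv.div_eq_of_hasWeakDiv hΩo _ _ (M.hasWeakDiv_rtField hd hΩo h0 hα)

/-- A property which holds almost everywhere in `Ω` holds almost everywhere in each cell. -/
theorem ae_cell_of_ae (M : SimplicialMesh Ω) (h0 : volume (frontier Ω) = 0) {P : Euc d → Prop}
    {T : Finset (Euc d)} (hT : T ∈ M.cells) (h : ∀ᵐ x ∂(volume.restrict Ω), P x) :
    ∀ᵐ x ∂(volume.restrict (convexHull ℝ (T : Set (Euc d)))), P x :=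
  ae_mono (M.restrict_le_of_mem h0 hT) h

theorem ae_mem_imp_of_ae_cell {P : Euc d → Prop}
    {T : Finset (Euc d)} (h : ∀ᵐ x ∂(volume.restrict (convexHull ℝ (T : Set (Euc d)))), P x) :
    ∀ᵐ x ∂(volume.restrict Ω), x ∈ convexHull ℝ (T : Set (Euc d)) → P x :=
  ae_restrict_of_ae ((ae_restrict_iff' (measurableSet_convexHull_finset T)).1 h)

theorem rtHdiv_mem_Vh (hd : 1 ≤ d) (hΩo : IsOpen Ω) (h0 : volume (frontier Ω) = 0)
    (M : SimplicialMesh Ω) {α : (Σ _ : Finset (Euc d), Euc d) → ℝ} (hα : M.FluxAntisymm α) :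
    M.rtHdiv hd hΩo h0 hα ∈ M.Vh := by
  intro T hT
  refine ⟨-∑ z ∈ T, (α ⟨T, z⟩ / (d * simplexVol T)) • z, ∑ z ∈ T, α ⟨T, z⟩ / (d * simplexVol T), ?_⟩
  filter_upwards [(M.memLp_rtField α).coeFn_toLp,
    ae_mem_imp_of_ae_cell (M.rtField_ae_eq α hT)] with x hx h hxT
  change (M.memLp_rtField α).toLp _ x = _
  rw [hx, h hxT, rtLocal, Finset.sum_smul]
  simp only [smul_sub, Finset.sum_sub_distrib]
  abel

/-- The values of a function in `W_h`. -/
theorem exists_values_of_mem_Wh (M : SimplicialMesh Ω) (h0 : volume (frontier Ω) = 0)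
    {w : L2Scal Ω} (hw : w ∈ M.Wh) : ∃ p : Finset (Euc d) → ℝ, ∀ T ∈ M.cells,
      w =ᵐ[volume.restrict (convexHull ℝ (T : Set (Euc d)))] fun _ => p T := by
  have : ∀ T ∈ M.cells, ∃ c : ℝ, w =ᵐ[volume.restrict (convexHull ℝ (T : Set (Euc d)))]
      fun _ => c := by
    intro T hT
    obtain ⟨c, hc⟩ := hw T hT
    refine ⟨c, ?_⟩
    filter_upwards [M.ae_cell_of_ae h0 hT hc,
      ae_restrict_mem (measurableSet_convexHull_finset T)] with x hx hxT using hx hxT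
  choose! p hp using this
  exact ⟨p, hp⟩

theorem integral_eq_sum_const (M : SimplicialMesh Ω) (h0 : volume (frontier Ω) = 0)
    {h : Euc d → ℝ} {p : Finset (Euc d) → ℝ}
    (hh : ∀ T ∈ M.cells, h =ᵐ[volume.restrict (convexHull ℝ (T : Set (Euc d)))] fun _ => p T) :
    ∫ x in Ω, h x = ∑ T ∈ M.cells, simplexVol T * p T := by
  rw [M.integral_eq_sum h0]
  · refine Finset.sum_congr rfl fun T hT => ?_
    rw [integral_congr_ae (hh T hT)]
    simp [simplexVol]
  · intro T hT
    refine IntegrableOn.congr_fun_ae ?_ (hh T hT).symm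
    exact integrableOn_const (isCompact_convexHull_finset T).measure_lt_top.ne

end SimplicialMesh

theorem norm_sq_eq_setIntegral {E F : Type*} [MeasurableSpace E] [NormedAddCommGroup F]
    [InnerProductSpace ℝ F] {μ : Measure E} (v : Lp F 2 μ) : ‖v‖ ^ 2 = ∫ x, ‖v x‖ ^ 2 ∂μ := by
  rw [← real_inner_self_eq_norm_sq, L2.inner_def]
  simp only [real_inner_self_eq_norm_sq]

/-! ### The inf-sup condition in dimension at least two. -/

namespace SimplicialMesh

variable {d : ℕ} {Ω : Set (Euc d)}

/-- The geometric bounds for a cell of a shape regular mesh in terms of the diameter `δ` of one of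
its faces. -/
theorem shape_bounds (hd : 2 ≤ d) {M : SimplicialMesh Ω} {σ R : ℝ} (hσ : 1 ≤ σ)
    (hR : ∀ y ∈ closure Ω, ‖y‖ ≤ R) (hM : M.IsShapeRegular σ)
    {q : Σ _ : Finset (Euc d), Euc d} (hq : q ∈ M.pairs) {δ : ℝ}
    (hδ : δ = Metric.diam (face q : Set (Euc d))) :
    0 < δ ∧
    volume.real (Metric.ball (0 : Euc d) 1) / (2 * σ) ^ d * δ ^ d ≤ simplexVol q.1 ∧
    (∀ x ∈ convexHull ℝ (q.1 : Set (Euc d)), ‖x - q.2‖ ≤ σ * δ) ∧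
    |simplexVol q.1 * bary q.1 q.2 0| ≤
      volume.real (Metric.ball (0 : Euc d) 1) * σ ^ (d + 1) * R * δ ^ (d - 1) := by
  obtain ⟨T, z⟩ := q
  obtain ⟨hT, hz⟩ := mem_pairs.1 hq
  simp only [face] at hT hz hδ ⊢
  have hTs := M.isSimplex hT
  obtain ⟨c, r, hr, hball, hdiam⟩ := hM T hT
  set h := Metric.diam (convexHull ℝ (T : Set (Euc d)))
  have hbdd : Bornology.IsBounded (convexHull ℝ (T : Set (Euc d))) :=
    (isCompact_convexHull_finset T).isBounded
  have hcard : (T.erase z).card = d := by rw [Finset.card_erase_of_mem hz, hTs.1]; rfl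
  -- Two distinct vertices of the face exist because `d ≥ 2`. They give `2 * r ≤ δ ≤ h ≤ σ * (2 *
  -- r)`, so the face diameter, which both adjacent cells share, measures the size of either cell.
  obtain ⟨w₁, hw₁, w₂, hw₂, hw⟩ := Finset.one_lt_card.1 (by omega : 1 < (T.erase z).card)
  have hsub : ((T.erase z : Finset (Euc d)) : Set (Euc d)) ⊆ convexHull ℝ (T : Set (Euc d)) :=
    fun w hw => subset_convexHull ℝ _ (Finset.mem_of_mem_erase hw)
  have hrδ : 2 * r ≤ δ := by
    rw [hδ]
    exact (two_mul_radius_le_dist hTs (Finset.mem_of_mem_erase hw₁) (Finset.mem_of_mem_erase hw₂)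
      hw hr hball).trans (Metric.dist_le_diam_of_mem (hbdd.subset hsub) hw₁ hw₂)
  have hδh : δ ≤ h := hδ ▸ Metric.diam_mono hsub hbdd
  have hhδ : h ≤ σ * δ := hdiam.trans (by gcongr)
  have hδr : δ ≤ σ * (2 * r) := hδh.trans hdiam
  have hδ0 : 0 < δ := by linarith
  set κ := volume.real (Metric.ball (0 : Euc d) 1)
  have hκ : 0 ≤ κ := measureReal_nonneg
  have hfr : Module.finrank ℝ (Euc d) = d := by simp
  have hd1 : (d - 1) + 1 = d := by omega
  refine ⟨hδ0, ?_, ?_, ?_⟩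
  · have h1 : volume.real (Metric.closedBall c r) ≤ simplexVol T :=
      measureReal_mono hball (isCompact_convexHull_finset T).measure_lt_top.ne
    rw [Measure.addHaar_real_closedBall _ _ hr.le, hfr] at h1
    refine le_trans ?_ h1
    rw [div_mul_eq_mul_div, mul_div_assoc, ← div_pow, mul_comm]
    gcongr
    rw [div_le_iff₀ (by positivity)]
    linarith
  · intro x hx
    rw [← dist_eq_norm]
    exact (Metric.dist_le_diam_of_mem hbdd hx (subset_convexHull ℝ _ hz)).trans hhδ
  · have h1 : simplexVol T ≤ (σ * δ) ^ d * κ := by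
      have h2 : convexHull ℝ (T : Set (Euc d)) ⊆ Metric.closedBall z (σ * δ) := fun x hx =>
        (Metric.dist_le_diam_of_mem hbdd hx (subset_convexHull ℝ _ hz)).trans hhδ
      refine (measureReal_mono h2 measure_closedBall_lt_top.ne).trans ?_
      rw [Measure.addHaar_real_closedBall _ _ (by positivity), hfr]
    have hw₁' := Finset.mem_of_mem_erase hw₁
    have h3 := abs_bary_zero_mul_le hTs hz hw₁' (Finset.ne_of_mem_erase hw₁).symm hr hball
    have h4 := h3.trans (hR w₁ (M.convexHull_subset hT (hsub hw₁)))
    have h5 : |bary T z 0| * δ ≤ σ * R := by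
      calc |bary T z 0| * δ ≤ |bary T z 0| * (σ * (2 * r)) := by gcongr
        _ = σ * (|bary T z 0| * (2 * r)) := by ring
        _ ≤ σ * R := by gcongr
    have hpow : δ ^ d = δ ^ (d - 1) * δ := by rw [← pow_succ, hd1]
    rw [abs_mul, abs_of_pos (simplexVol_pos hTs)]
    calc simplexVol T * |bary T z 0| ≤ (σ * δ) ^ d * κ * |bary T z 0| := by gcongr
      _ = κ * σ ^ d * δ ^ (d - 1) * (|bary T z 0| * δ) := by
          rw [mul_pow, hpow]; ring
      _ ≤ κ * σ ^ d * δ ^ (d - 1) * (σ * R) := by gcongr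
      _ = κ * σ ^ (d + 1) * R * δ ^ (d - 1) := by ring

/-- The sum of the values of `p` on the cells with face `F`. -/
def fiberSum (M : SimplicialMesh Ω) (p : Finset (Euc d) → ℝ) (F : Finset (Euc d)) : ℝ :=
  ∑ q ∈ M.fiber F, p q.1

/-- The jump of `p` across a face, where `p` is extended by `0` outside of `Ω`. -/
def jump (M : SimplicialMesh Ω) (p : Finset (Euc d) → ℝ) (q : Σ _ : Finset (Euc d), Euc d) : ℝ :=
  2 * p q.1 - M.fiberSum p (face q)

/-- The weight of a face in the discrete energy. -/
def faceWeight (F : Finset (Euc d)) : ℝ := Metric.diam (F : Set (Euc d)) ^ (d - 2)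

/-- The discrete energy of `p`. -/
def energy (M : SimplicialMesh Ω) (p : Finset (Euc d) → ℝ) : ℝ :=
  ∑ q ∈ M.pairs, faceWeight (face q) * M.jump p q ^ 2

/-- The flux field given by the weighted jumps of `p`. -/
def jumpFlux (M : SimplicialMesh Ω) (p : Finset (Euc d) → ℝ) (q : Σ _ : Finset (Euc d), Euc d) :
    ℝ := faceWeight (face q) * M.jump p q

theorem jump_cases (hd : 1 ≤ d) {M : SimplicialMesh Ω} (p : Finset (Euc d) → ℝ)
    {q : Σ _ : Finset (Euc d), Euc d} (hq : q ∈ M.pairs) :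
    (M.fiber (face q) = {q} ∧ M.jump p q = p q.1) ∨
      ∃ q' ∈ M.pairs, q ≠ q' ∧ face q = face q' ∧ M.jump p q = p q.1 - p q'.1 ∧
        M.jump p q' = p q'.1 - p q.1 ∧
        ∀ f : (Σ _ : Finset (Euc d), Euc d) → ℝ, ∑ t ∈ M.fiber (face q), f t = f q + f q' := by
  rcases fiber_cases hd hq with h | ⟨q', hq', hne, hf, h⟩
  · refine Or.inl ⟨h, ?_⟩
    rw [jump, fiberSum, h, Finset.sum_singleton]; ring
  · refine Or.inr ⟨q', hq', hne, hf, ?_, ?_, h⟩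
    · rw [jump, fiberSum, h]; ring
    · rw [jump, fiberSum, ← hf, h]; ring

theorem fluxAntisymm_jumpFlux (hd : 1 ≤ d) (M : SimplicialMesh Ω) (p : Finset (Euc d) → ℝ) :
    M.FluxAntisymm (M.jumpFlux p) := by
  intro q hq q' hq' hne hf
  have : M.jump p q' = -M.jump p q := by
    have h1 : M.fiberSum p (face q) = p q.1 + p q'.1 := by
      rcases fiber_cases hd hq with h | ⟨t, ht, hne', hf', h⟩
      · have : q' ∈ M.fiber (face q) := mem_fiber.2 ⟨hq', hf.symm⟩
        rw [h, Finset.mem_singleton] at this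
        exact absurd this.symm hne
      -- Summing the indicator of `q'` over the fiber identifies the neighbour `t` with `q'`.
      · have h2 := h fun u => if u = q' then 1 else 0
        have h3 : ∑ u ∈ M.fiber (face q), (if u = q' then (1 : ℝ) else 0) = 1 := by
          classical
          rw [Finset.sum_ite_eq_of_mem' _ _ _ (mem_fiber.2 ⟨hq', hf.symm⟩)]
        have h4 : t = q' := by
          by_contra hcon
          rw [h3, if_neg hne, if_neg hcon] at h2
          norm_num at h2
        rw [fiberSum, h, h4]
    rw [jump, jump, ← hf, h1]; ring
  rw [jumpFlux, jumpFlux, this, ← hf]; ring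

theorem faceWeight_nonneg (F : Finset (Euc d)) : 0 ≤ faceWeight F :=
  pow_nonneg Metric.diam_nonneg _

/-- Summation by parts: the sum on the right is `∫ w div v`. On an interior face its two terms add
up to the weighted squared jump, which the energy counts twice; on a boundary face the factor 2 is
not needed. -/
theorem energy_le_sum_mul_jumpFlux (hd : 1 ≤ d) (M : SimplicialMesh Ω) (p : Finset (Euc d) → ℝ) :
    M.energy p ≤ 2 * ∑ q ∈ M.pairs, p q.1 * M.jumpFlux p q := by
  classical
  rw [energy, sum_pairs_eq_sum_fiber, sum_pairs_eq_sum_fiber, Finset.mul_sum]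
  refine Finset.sum_le_sum fun F hF => ?_
  obtain ⟨q, hq, rfl⟩ := Finset.mem_image.1 hF
  have hw := faceWeight_nonneg (face q)
  rcases jump_cases hd p hq with ⟨h, hj⟩ | ⟨q', hq', hne, hf, hj, hj', h⟩
  · rw [h, Finset.sum_singleton, Finset.sum_singleton, jumpFlux, hj]
    nlinarith [mul_nonneg hw (sq_nonneg (p q.1))]
  · rw [h, h, jumpFlux, jumpFlux, hj, hj', ← hf]
    nlinarith

/-- The discrete form of `d ∫ f = ∫ f div x`: `d * simplexVol T * bary T z 0` is the outward flux of
the position field through the face opposite to `z`. -/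
theorem sum_simplexVol_mul_bary (M : SimplicialMesh Ω) (f : Finset (Euc d) → ℝ) :
    ∑ q ∈ M.pairs, simplexVol q.1 * bary q.1 q.2 0 * f q.1 = ∑ T ∈ M.cells, simplexVol T * f T := by
  rw [pairs, Finset.sum_sigma]
  refine Finset.sum_congr rfl fun T hT => ?_
  have := (M.isSimplex hT).sum_bary 0
  calc ∑ z ∈ T, simplexVol T * bary T z 0 * f T
      = simplexVol T * f T * ∑ z ∈ T, bary T z 0 := by
        rw [Finset.mul_sum]; exact Finset.sum_congr rfl fun _ _ => by ring
    _ = _ := by rw [this, mul_one]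

/-- Continuity of the normal component of the position field, read off from the volume ratio and the
opposite orientation of neighbours. -/
theorem flux_antisymm_simplexVol_mul_bary (hd : 1 ≤ d) {M : SimplicialMesh Ω}
    {q q' : Σ _ : Finset (Euc d), Euc d}
    (hq : q ∈ M.pairs) (hq' : q' ∈ M.pairs) (hne : q ≠ q') (hf : face q = face q') :
    simplexVol q'.1 * bary q'.1 q'.2 0 = -(simplexVol q.1 * bary q.1 q.2 0) := by
  obtain ⟨h1, h2⟩ := mem_pairs.1 hq
  obtain ⟨h1', h2'⟩ := mem_pairs.1 hq'
  rw [simplexVol_eq_abs_bary_mul (M.isSimplex h1) h2 h2' hf,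
    abs_of_neg (bary_neg hd hq hq' hf hne),
    bary_eq_mul_bary (M.isSimplex h1) (M.isSimplex h1') h2 h2' hf 0]
  ring

/-- The discrete Poincaré inequality for piecewise constant functions. -/
theorem sum_sq_le_energy (hd : 2 ≤ d) (M : SimplicialMesh Ω) (p : Finset (Euc d) → ℝ)
    {k₁ k₃ : ℝ} (hk₁ : 0 < k₁)
    (h₁ : ∀ q ∈ M.pairs, k₁ * Metric.diam (face q : Set (Euc d)) ^ d ≤ simplexVol q.1)
    (h₃ : ∀ q ∈ M.pairs, |simplexVol q.1 * bary q.1 q.2 0| ≤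
      k₃ * Metric.diam (face q : Set (Euc d)) ^ (d - 1)) :
    ∑ T ∈ M.cells, simplexVol T * p T ^ 2 ≤ 2 * (d + 1) * k₃ ^ 2 / k₁ * M.energy p := by
  classical
  set N := ∑ T ∈ M.cells, simplexVol T * p T ^ 2 with hN
  -- Each cell is counted once for each of its `d + 1` faces, so this choice makes the term to be
  -- absorbed exactly `N / 2`.
  set ε : ℝ := k₁ / (2 * (d + 1)) with hε
  have hε0 : 0 < ε := by positivity
  have key : N ≤ ∑ q ∈ M.pairs, (k₃ ^ 2 / (2 * ε) * (faceWeight (face q) * M.jump p q ^ 2) +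
      ε / k₁ * (simplexVol q.1 * p q.1 ^ 2)) := by
    rw [hN, ← M.sum_simplexVol_mul_bary fun T => p T ^ 2, sum_pairs_eq_sum_fiber,
      sum_pairs_eq_sum_fiber]
    refine Finset.sum_le_sum fun F hF => ?_
    obtain ⟨q, hq, rfl⟩ := Finset.mem_image.1 hF
    set δ := Metric.diam (face q : Set (Euc d)) with hδ
    have hδ0 : 0 ≤ δ := Metric.diam_nonneg
    have hW : faceWeight (face q) = δ ^ (d - 2) := rfl
    set W := faceWeight (face q)
    have hW0 : 0 ≤ W := faceWeight_nonneg _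
    have hd1 : δ ^ (d - 1) = W * δ := by
      rw [hW, ← pow_succ]; congr 1; omega
    have hd2 : δ ^ d = W * δ ^ 2 := by
      rw [hW, ← pow_add]; congr 1; omega
    have young : ∀ a b : ℝ, k₃ * (W * δ) * (|a| * |b|) ≤
        k₃ ^ 2 / (2 * ε) * (W * a ^ 2) + ε / 2 * (W * δ ^ 2 * b ^ 2) := by
      intro a b
      have h1 : k₃ * δ * (|a| * |b|) ≤ k₃ ^ 2 / (2 * ε) * a ^ 2 + ε / 2 * (δ ^ 2 * b ^ 2) := by
        have h2 := sq_nonneg (k₃ * |a| - ε * (δ * |b|))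
        have h3 : k₃ ^ 2 / (2 * ε) * a ^ 2 + ε / 2 * (δ ^ 2 * b ^ 2) - k₃ * δ * (|a| * |b|) =
            (k₃ * |a| - ε * (δ * |b|)) ^ 2 / (2 * ε) := by
          rw [← sq_abs a, ← sq_abs b]
          field_simp
          ring
        have h4 : 0 ≤ (k₃ * |a| - ε * (δ * |b|)) ^ 2 / (2 * ε) := by positivity
        linarith
      calc k₃ * (W * δ) * (|a| * |b|) = W * (k₃ * δ * (|a| * |b|)) := by ring
        _ ≤ W * (k₃ ^ 2 / (2 * ε) * a ^ 2 + ε / 2 * (δ ^ 2 * b ^ 2)) := by gcongr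
        _ = _ := by ring
    have hvol : ∀ t ∈ M.pairs, face t = face q → ε * (W * δ ^ 2 * p t.1 ^ 2) ≤
        ε / k₁ * (simplexVol t.1 * p t.1 ^ 2) := by
      intro t ht htf
      have h1 := h₁ t ht
      rw [htf, ← hδ, hd2] at h1
      have h2 : ε / k₁ * (k₁ * (W * δ ^ 2) * p t.1 ^ 2) ≤ ε / k₁ * (simplexVol t.1 * p t.1 ^ 2) := by
        gcongr
      refine le_trans (le_of_eq ?_) h2
      field_simp
    have hβ := h₃ q hq
    rw [← hδ, hd1] at hβ
    have hvq := hvol q hq rfl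
    rcases jump_cases (by omega) p hq with ⟨h, hj⟩ | ⟨q', hq', hne, hf, hj, hj', h⟩
    · rw [h, Finset.sum_singleton, Finset.sum_singleton, hj]
      have h1 : simplexVol q.1 * bary q.1 q.2 0 * p q.1 ^ 2 ≤
          k₃ * (W * δ) * (|p q.1| * |p q.1|) := by
        rw [abs_mul_abs_self, ← sq]
        exact mul_le_mul_of_nonneg_right ((le_abs_self _).trans hβ) (sq_nonneg _)
      have h2 := young (p q.1) (p q.1)
      have h3 : 0 ≤ ε * (W * δ ^ 2 * p q.1 ^ 2) := by positivity
      linarith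
    -- The two terms combine to a multiple of `p² - p'² = (p - p')(p + p')`. Young's inequality
    -- splits the product, and `(p + p')² ≤ 2p² + 2p'²` returns the second part to the cells.
    · rw [h, h, hj, hj', flux_antisymm_simplexVol_mul_bary (by omega) hq hq' hne hf, ← hf]
      have hvq' := hvol q' hq' hf.symm
      have h1 : simplexVol q.1 * bary q.1 q.2 0 * ((p q.1 - p q'.1) * (p q.1 + p q'.1)) ≤
          k₃ * (W * δ) * (|p q.1 - p q'.1| * |p q.1 + p q'.1|) := by
        refine (le_abs_self _).trans ?_
        rw [abs_mul, abs_mul (p q.1 - p q'.1)]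
        exact mul_le_mul_of_nonneg_right hβ (by positivity)
      have h2 := young (p q.1 - p q'.1) (p q.1 + p q'.1)
      have h3 : 0 ≤ ε * (W * δ ^ 2) * (p q.1 - p q'.1) ^ 2 := by positivity
      have h4 : 0 ≤ k₃ ^ 2 / (2 * ε) * (W * (p q'.1 - p q.1) ^ 2) := by positivity
      change _ ≤ _ + _ + (k₃ ^ 2 / (2 * ε) * (W * (p q'.1 - p q.1) ^ 2) + _)
      nlinarith
  rw [Finset.sum_add_distrib, ← Finset.mul_sum, ← Finset.mul_sum] at key
  have hcount : ∑ q ∈ M.pairs, simplexVol q.1 * p q.1 ^ 2 = (d + 1) * N := by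
    rw [pairs, Finset.sum_sigma, hN, Finset.mul_sum]
    refine Finset.sum_congr rfl fun T hT => ?_
    simp only [Finset.sum_const, M.card_eq T hT, nsmul_eq_mul]
    push_cast; ring
  rw [hcount] at key
  change N ≤ k₃ ^ 2 / (2 * ε) * M.energy p + _ at key
  have e1 : ε / k₁ * ((d + 1) * N) = N / 2 := by rw [hε]; field_simp
  have e2 : k₃ ^ 2 / (2 * ε) = (2 * (d + 1) * k₃ ^ 2 / k₁) / 2 := by rw [hε]; field_simp
  rw [e1, e2] at key
  linarith

end SimplicialMesh

namespace SimplicialMesh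

variable {d : ℕ} {Ω : Set (Euc d)}

/-- Scaling: a flux `δ^(d-2) J` gives a field of size about `δ^(d-2) J δ / |T|`, whose squared norm
on `T` is at most a constant times `δ^(d-2) J²` because `|T|` is at least of order `δ^d`. This is
what dictates the exponent of `faceWeight`; the factor `d + 1` comes from Cauchy-Schwarz over the
vertices. -/
theorem norm_sq_rtHdiv_le (hd : 2 ≤ d) (hΩo : IsOpen Ω) (h0 : volume (frontier Ω) = 0)
    (M : SimplicialMesh Ω) (p : Finset (Euc d) → ℝ)
    {k₁ σ : ℝ} (hk₁ : 0 < k₁)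
    (h₁ : ∀ q ∈ M.pairs, k₁ * Metric.diam (face q : Set (Euc d)) ^ d ≤ simplexVol q.1)
    (h₂ : ∀ q ∈ M.pairs, ∀ x ∈ convexHull ℝ (q.1 : Set (Euc d)),
      ‖x - q.2‖ ≤ σ * Metric.diam (face q : Set (Euc d))) :
    ‖(M.rtHdiv (by omega) hΩo h0 (M.fluxAntisymm_jumpFlux (by omega) p)).toL2‖ ^ 2 ≤
      (d + 1) * σ ^ 2 / k₁ * M.energy p := by
  have e0 : ‖(M.rtHdiv (by omega) hΩo h0 (M.fluxAntisymm_jumpFlux (by omega) p)).toL2‖ ^ 2 =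
      ∫ x in Ω, ‖M.rtField (M.jumpFlux p) x‖ ^ 2 := by
    rw [norm_sq_eq_setIntegral]
    refine integral_congr_ae ?_
    filter_upwards [(M.memLp_rtField (M.jumpFlux p)).coeFn_toLp] with x hx
    change ‖(M.memLp_rtField (M.jumpFlux p)).toLp _ x‖ ^ 2 = _
    rw [hx]
  have a1 : ∀ T ∈ M.cells, (fun x => ‖M.rtField (M.jumpFlux p) x‖ ^ 2)
      =ᵐ[volume.restrict (convexHull ℝ (T : Set (Euc d)))]
        fun x => ‖rtLocal (M.jumpFlux p) T x‖ ^ 2 := by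
    intro T hT
    filter_upwards [M.rtField_ae_eq (M.jumpFlux p) hT] with x hx
    rw [hx]
  have hint : ∀ T, IntegrableOn (fun x => ‖rtLocal (M.jumpFlux p) T x‖ ^ 2)
      (convexHull ℝ (T : Set (Euc d))) := by
    intro T
    have := continuous_rtLocal (M.jumpFlux p) T
    exact (by fun_prop : Continuous fun x => ‖rtLocal (M.jumpFlux p) T x‖
      ^ 2).continuousOn.integrableOn_compact (isCompact_convexHull_finset T)
  rw [e0, M.integral_eq_sum h0 fun T hT => IntegrableOn.congr_fun_ae (hint T) (a1 T hT).symm,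
    Finset.sum_congr rfl fun T hT => integral_congr_ae (a1 T hT), energy, pairs, Finset.sum_sigma,
    Finset.mul_sum]
  refine Finset.sum_le_sum fun T hT => ?_
  have hTs := M.isSimplex hT
  have hV := simplexVol_pos hTs
  set B := (d + 1) * σ ^ 2 / k₁ *
    ∑ z ∈ T, faceWeight (face ⟨T, z⟩) * M.jump p ⟨T, z⟩ ^ 2 with hB
  have hpt : ∀ x ∈ convexHull ℝ (T : Set (Euc d)),
      ‖rtLocal (M.jumpFlux p) T x‖ ^ 2 ≤ B / simplexVol T := by
    intro x hx
    have hterm : ∀ z ∈ T, ‖(M.jumpFlux p ⟨T, z⟩ / (d * simplexVol T)) • (x - z)‖ ^ 2 ≤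
        σ ^ 2 / (k₁ * simplexVol T) *
          (faceWeight (face ⟨T, z⟩) * M.jump p ⟨T, z⟩ ^ 2) := by
      intro z hz
      have hq : (⟨T, z⟩ : Σ _ : Finset (Euc d), Euc d) ∈ M.pairs := mem_pairs.2 ⟨hT, hz⟩
      have g1 := h₁ _ hq
      have g2 := h₂ _ hq x hx
      simp only at g1 g2
      set δ := Metric.diam (face ⟨T, z⟩ : Set (Euc d)) with hδ
      have hδ0 : 0 ≤ δ := Metric.diam_nonneg
      have hW : faceWeight (face ⟨T, z⟩) = δ ^ (d - 2) := rfl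
      rw [jumpFlux]
      set W := faceWeight (face ⟨T, z⟩)
      set J := M.jump p ⟨T, z⟩
      have hW0 : 0 ≤ W := faceWeight_nonneg _
      have hd2 : δ ^ d = W * δ ^ 2 := by
        rw [hW, ← pow_add]; congr 1; omega
      rw [hd2] at g1
      have hd1 : (1 : ℝ) ≤ d := by exact_mod_cast (by omega : 1 ≤ d)
      rw [norm_smul, mul_pow, Real.norm_eq_abs, sq_abs, div_pow]
      calc (W * J) ^ 2 / (d * simplexVol T) ^ 2 * ‖x - z‖ ^ 2
          ≤ (W * J) ^ 2 / (1 * simplexVol T) ^ 2 * (σ * δ) ^ 2 := by gcongr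
        _ = σ ^ 2 / (k₁ * simplexVol T) * (W * J ^ 2) *
            (k₁ * (W * δ ^ 2) / simplexVol T) := by field_simp
        _ ≤ σ ^ 2 / (k₁ * simplexVol T) * (W * J ^ 2) * 1 := by
            gcongr
            rw [div_le_one hV]
            exact g1
        _ = _ := mul_one _
    calc ‖rtLocal (M.jumpFlux p) T x‖ ^ 2
        ≤ (∑ z ∈ T, ‖(M.jumpFlux p ⟨T, z⟩ / (d * simplexVol T)) • (x - z)‖) ^ 2 := by
          gcongr
          exact norm_sum_le _ _
      _ ≤ T.card * ∑ z ∈ T, ‖(M.jumpFlux p ⟨T, z⟩ / (d * simplexVol T)) • (x - z)‖ ^ 2 :=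
          sq_sum_le_card_mul_sum_sq
      _ ≤ T.card * ∑ z ∈ T, σ ^ 2 / (k₁ * simplexVol T) *
          (faceWeight (face ⟨T, z⟩) * M.jump p ⟨T, z⟩ ^ 2) := by
          gcongr with z hz
          exact hterm z hz
      _ = B / simplexVol T := by
          rw [← Finset.mul_sum, M.card_eq T hT, hB]
          push_cast
          field_simp
  calc ∫ x in convexHull ℝ (T : Set (Euc d)), ‖rtLocal (M.jumpFlux p) T x‖ ^ 2
      ≤ ∫ x in convexHull ℝ (T : Set (Euc d)), B / simplexVol T :=
        setIntegral_mono_on (hint T)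
          (integrableOn_const (isCompact_convexHull_finset T).measure_lt_top.ne)
          (measurableSet_convexHull_finset T) hpt
    _ = B := by
        rw [setIntegral_const, smul_eq_mul, ← simplexVol]
        field_simp

/-- The uniform inf-sup condition of the lowest order Raviart-Thomas element in dimension at
least two. -/
theorem exists_infsup_of_two_le (hd : 2 ≤ d) (hΩo : IsOpen Ω) (hΩb : Bornology.IsBounded Ω)
    (h0 : volume (frontier Ω) = 0) (σ : ℝ) :
    ∃ C : ℝ, 0 < C ∧ ∀ M : SimplicialMesh Ω, M.IsShapeRegular σ → ∀ w ∈ M.Wh, ∃ v ∈ M.Vh,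
      ‖w‖ ^ 2 ≤ C * ∫ x in Ω, w x * v.div x ∧ ‖v.toL2‖ ^ 2 ≤ C * ∫ x in Ω, w x * v.div x := by
  obtain ⟨R, hR⟩ := (Metric.isBounded_iff_subset_closedBall (0 : Euc d)).1 hΩb.closure
  have hR' : ∀ y ∈ closure Ω, ‖y‖ ≤ R := fun y hy => mem_closedBall_zero_iff.1 (hR hy)
  set s := max σ 1 with hs
  have hs1 : 1 ≤ s := le_max_right _ _
  set κ := volume.real (Metric.ball (0 : Euc d) 1) with hκ
  have hκ0 : 0 < κ := ENNReal.toReal_pos (Metric.measure_ball_pos _ _ one_pos).ne'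
    measure_ball_lt_top.ne
  set k₁ := κ / (2 * s) ^ d with hk₁
  have hk₁0 : 0 < k₁ := by positivity
  set k₃ := κ * s ^ (d + 1) * R with hk₃
  set A := 2 * (d + 1) * k₃ ^ 2 / k₁ with hA
  set B := (d + 1) * s ^ 2 / k₁ with hB
  have hA0 : 0 ≤ A := by positivity
  have hB0 : 0 < B := by positivity
  -- `A` and `B` are the constants of the Poincaré inequality and of the norm bound; the factor 2 is
  -- that of `energy_le_sum_mul_jumpFlux`.
  refine ⟨2 * (A + B), by positivity, fun M hM w hw => ?_⟩
  have hMs : M.IsShapeRegular s := fun T hT => by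
    obtain ⟨c, r, hr, hb, h⟩ := hM T hT
    exact ⟨c, r, hr, hb, h.trans (by gcongr; exact le_max_left _ _)⟩
  obtain ⟨p, hp⟩ := M.exists_values_of_mem_Wh h0 hw
  have hbounds := fun q hq => shape_bounds (q := q) hd hs1 hR' hMs hq rfl
  have hα := M.fluxAntisymm_jumpFlux (by omega : 1 ≤ d) p
  have hnorm := M.norm_sq_rtHdiv_le hd hΩo h0 p hk₁0
    (fun q hq => (hbounds q hq).2.1) (fun q hq => (hbounds q hq).2.2.1)
  have hpoin := M.sum_sq_le_energy hd p hk₁0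
    (fun q hq => (hbounds q hq).2.1) (fun q hq => (hbounds q hq).2.2.2)
  have hen := M.energy_le_sum_mul_jumpFlux (by omega) p
  have hE0 : 0 ≤ M.energy p := Finset.sum_nonneg fun q _ =>
    mul_nonneg (faceWeight_nonneg _) (sq_nonneg _)
  refine ⟨_, M.rtHdiv_mem_Vh (by omega) hΩo h0 hα, ?_⟩
  have hpair : ∫ x in Ω, w x * (M.rtHdiv (by omega) hΩo h0 hα).div x =
      ∑ q ∈ M.pairs, p q.1 * M.jumpFlux p q := by
    rw [div_rtHdiv, M.integral_eq_sum_const h0 (p := fun T => p T * rtLocalDiv (M.jumpFlux p) T)]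
    · rw [pairs, Finset.sum_sigma]
      refine Finset.sum_congr rfl fun T hT => ?_
      have := (simplexVol_pos (M.isSimplex hT)).ne'
      change _ = ∑ z ∈ T, p T * M.jumpFlux p ⟨T, z⟩
      rw [rtLocalDiv, ← Finset.mul_sum]
      field_simp
    · intro T hT
      filter_upwards [hp T hT, M.piecewiseConst_ae_eq (rtLocalDiv (M.jumpFlux p)) hT,
        M.ae_cell_of_ae h0 hT
          (M.memLp_piecewiseConst (rtLocalDiv (M.jumpFlux p))).coeFn_toLp] with x h1 h2 h3
      rw [h1, h3, h2]
  have hw2 : ‖w‖ ^ 2 = ∑ T ∈ M.cells, simplexVol T * p T ^ 2 := by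
    rw [norm_sq_eq_setIntegral, M.integral_eq_sum_const h0 (p := fun T => p T ^ 2)]
    intro T hT
    filter_upwards [hp T hT] with x hx
    rw [hx, Real.norm_eq_abs, sq_abs]
  rw [hpair, hw2]
  set I := ∑ q ∈ M.pairs, p q.1 * M.jumpFlux p q
  constructor
  · refine hpoin.trans ?_
    nlinarith
  · refine hnorm.trans ?_
    nlinarith

end SimplicialMesh

/-! ### The inf-sup condition in dimension one, by primitives. -/

/-- The coordinate of a point on the line. -/
def lineCoord : Euc 1 ≃ᵐ ℝ :=
  (MeasurableEquiv.toLp 2 (Fin 1 → ℝ)).symm.trans (MeasurableEquiv.funUnique (Fin 1) ℝ)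

theorem lineCoord_apply (x : Euc 1) : lineCoord x = x 0 := rfl

theorem measurePreserving_lineCoord : MeasurePreserving lineCoord :=
  (volume_preserving_funUnique (Fin 1) ℝ).comp (PiLp.volume_preserving_ofLp (Fin 1))

/-- The unit vector of the line. -/
def lineVec : Euc 1 := EuclideanSpace.single 0 1

theorem norm_lineVec : ‖lineVec‖ = 1 := by simp [lineVec]

theorem smul_lineVec (x : Euc 1) : x 0 • lineVec = x := by
  ext i
  fin_cases i
  simp [lineVec]

theorem setIntegral_fderiv_lineVec {φ : Euc 1 → ℝ} (hφ : ContDiff ℝ 1 φ) (hc : HasCompactSupport φ)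
    (y : Euc 1) : ∫ x in {x : Euc 1 | y 0 < x 0}, fderiv ℝ φ x lineVec = -φ y := by
  have hψ : ContDiff ℝ 1 fun t : ℝ => φ (t • lineVec) :=
    hφ.comp (contDiff_id.smul contDiff_const)
  have hψc : HasCompactSupport fun t : ℝ => φ (t • lineVec) := by
    have hiso : Isometry fun t : ℝ => t • lineVec := by
      refine Isometry.of_dist_eq fun s t => ?_
      rw [dist_eq_norm, ← sub_smul, norm_smul, norm_lineVec, mul_one, ← dist_eq_norm]
    exact hc.comp_isClosedEmbedding hiso.isClosedEmbedding
  have hd : ∀ t : ℝ, deriv (fun t : ℝ => φ (t • lineVec)) t = fderiv ℝ φ (t • lineVec) lineVec := by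
    intro t
    have h1 : HasDerivAt (fun t : ℝ => t • lineVec) lineVec t := by
      simpa using (hasDerivAt_id t).smul_const lineVec
    exact (((hφ.differentiable (by norm_num)) _).hasFDerivAt.comp_hasDerivAt t h1).deriv
  have h := hψc.integral_Ioi_deriv_eq hψ (y 0)
  simp only [hd, smul_lineVec] at h
  rw [← h]
  have hpre : {x : Euc 1 | y 0 < x 0} = lineCoord ⁻¹' Ioi (y 0) := rfl
  rw [hpre, ← measurePreserving_lineCoord.setIntegral_preimage_emb lineCoord.measurableEmbedding]
  simp only [lineCoord_apply, smul_lineVec]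

theorem volume_real_coord_Ico {a b : ℝ} (hab : a ≤ b) :
    volume.real {x : Euc 1 | a ≤ x 0 ∧ x 0 < b} = b - a := by
  have hpre : {x : Euc 1 | a ≤ x 0 ∧ x 0 < b} = lineCoord ⁻¹' Ico a b := rfl
  rw [hpre, Measure.real, measurePreserving_lineCoord.measure_preimage measurableSet_Ico.nullMeasurableSet,
    Real.volume_Ico, ENNReal.toReal_ofReal (by linarith)]

theorem Convex.mem_of_coord_mem_Icc {C : Set (Euc 1)} (hC : Convex ℝ C) {a b y : Euc 1} (ha : a ∈ C)
    (hb : b ∈ C) (hay : a 0 ≤ y 0) (hyb : y 0 ≤ b 0) : y ∈ C := by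
  rcases eq_or_lt_of_le (hay.trans hyb) with h | h
  · have : y = a := by
      rw [← smul_lineVec y, ← smul_lineVec a, le_antisymm (h ▸ hyb) hay]
    rwa [this]
  · have h0 : 0 < b 0 - a 0 := sub_pos.2 h
    have : y = AffineMap.lineMap a b ((y 0 - a 0) / (b 0 - a 0)) := by
      ext i
      fin_cases i
      rw [AffineMap.lineMap_apply_module']
      simp
      field_simp
      ring
    rw [this]
    exact hC.lineMap_mem ha hb ⟨div_nonneg (by linarith) h0.le, (div_le_one h0).2 (by linarith)⟩

section Primitive

variable {Ω : Set (Euc 1)}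

/-- The primitive of a function on the line, as a function of the point. -/
def linePrimitive (w : L2Scal Ω) (x : Euc 1) : ℝ :=
  ∫ y in Ω, {y : Euc 1 | y 0 < x 0}.indicator w y

theorem measurableSet_coord_lt (x : Euc 1) : MeasurableSet {y : Euc 1 | y 0 < x 0} :=
  (isOpen_lt (by fun_prop) continuous_const).measurableSet

theorem integrable_L2Scal [IsFiniteMeasure (volume.restrict Ω)] (w : L2Scal Ω) :
    Integrable w (volume.restrict Ω) := (Lp.memLp w).integrable (by norm_num)

/-- Cauchy-Schwarz against the indicator of a half-line, whose squared norm in `L²(Ω)` is at most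
the measure of `Ω`. -/
theorem abs_linePrimitive_sq_le [IsFiniteMeasure (volume.restrict Ω)] (w : L2Scal Ω) (x : Euc 1) :
    linePrimitive w x ^ 2 ≤ volume.real Ω * ‖w‖ ^ 2 := by
  set μ := volume.restrict Ω with hμ
  have hS := measurableSet_coord_lt x
  have hfin : μ {y : Euc 1 | y 0 < x 0} ≠ ⊤ := measure_ne_top _ _
  have h1 : linePrimitive w x = inner ℝ (indicatorConstLp 2 hS hfin (1 : ℝ)) w := by
    rw [L2.inner_indicatorConstLp_one, linePrimitive, integral_indicator hS]
  have h2 := abs_real_inner_le_norm (indicatorConstLp 2 hS hfin (1 : ℝ)) w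
  rw [← h1] at h2
  have h3 : ‖indicatorConstLp 2 hS hfin (1 : ℝ)‖ ^ 2 ≤ volume.real Ω := by
    rw [norm_indicatorConstLp (by norm_num) (by norm_num), norm_one, one_mul]
    have : (μ.real {y : Euc 1 | y 0 < x 0} ^ (1 / (2 : ENNReal).toReal)) ^ 2 =
        μ.real {y : Euc 1 | y 0 < x 0} := by
      rw [← Real.rpow_natCast, ← Real.rpow_mul measureReal_nonneg]
      norm_num
    rw [this]
    refine (measureReal_mono (subset_univ _)).trans (le_of_eq ?_)
    rw [hμ, measureReal_restrict_apply MeasurableSet.univ, univ_inter]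
  calc linePrimitive w x ^ 2 = |linePrimitive w x| ^ 2 := (sq_abs _).symm
    _ ≤ (‖indicatorConstLp 2 hS hfin (1 : ℝ)‖ * ‖w‖) ^ 2 := by gcongr
    _ = ‖indicatorConstLp 2 hS hfin (1 : ℝ)‖ ^ 2 * ‖w‖ ^ 2 := by ring
    _ ≤ _ := by gcongr

theorem measurableSet_coord_lt_prod : MeasurableSet {q : Euc 1 × Euc 1 | q.2 0 < q.1 0} :=
  (isOpen_lt (by fun_prop) (by fun_prop)).measurableSet

theorem aestronglyMeasurable_linePrimitive [IsFiniteMeasure (volume.restrict Ω)] (w : L2Scal Ω) :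
    AEStronglyMeasurable (linePrimitive w) (volume.restrict Ω) := by
  have h1 : Integrable (fun q : Euc 1 × Euc 1 => (1 : ℝ) * w q.2)
      ((volume.restrict Ω).prod (volume.restrict Ω)) :=
    (integrable_const (1 : ℝ)).mul_prod (integrable_L2Scal w)
  have h2 := (h1.indicator measurableSet_coord_lt_prod).integral_prod_left.aestronglyMeasurable
  refine h2.congr (Filter.Eventually.of_forall fun x => ?_)
  refine integral_congr_ae (Filter.Eventually.of_forall fun y => ?_)
  simp [indicator]

theorem memLp_linePrimitive [IsFiniteMeasure (volume.restrict Ω)] (w : L2Scal Ω) :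
    MemLp (fun x => linePrimitive w x • lineVec) 2 (volume.restrict Ω) := by
  refine MemLp.of_bound ((aestronglyMeasurable_linePrimitive w).smul_const _)
    (Real.sqrt (volume.real Ω * ‖w‖ ^ 2)) (Filter.Eventually.of_forall fun x => ?_)
  rw [norm_smul, norm_lineVec, mul_one, Real.norm_eq_abs]
  exact Real.abs_le_sqrt (abs_linePrimitive_sq_le w x)

/-- Fubini: integrating `φ'(x) w(y)` over `y < x` first in `x` leaves `-φ(y) w(y)`. Restricting to
`Ω` loses nothing, since `φ'` is supported there. -/
theorem hasWeakDiv_linePrimitive [IsFiniteMeasure (volume.restrict Ω)] (w : L2Scal Ω) :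
    HasWeakDiv Ω (memLp_linePrimitive w).toLp w := by
  intro φ hφ hc hs
  have hφ1 : ContDiff ℝ 1 φ := hφ.of_le (by exact_mod_cast le_top)
  have hgc : Continuous fun x => fderiv ℝ φ x lineVec := by
    have := hφ1.continuous_fderiv (by norm_num)
    fun_prop
  have hgs : HasCompactSupport fun x => fderiv ℝ φ x lineVec := hc.fderiv_apply ℝ lineVec
  have hgi : Integrable (fun x => fderiv ℝ φ x lineVec) (volume.restrict Ω) :=
    (hgc.integrable_of_hasCompactSupport hgs).restrict
  have e1 : ∫ x in Ω, inner ℝ ((memLp_linePrimitive w).toLp _ x) (gradient φ x) =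
      ∫ x in Ω, ∫ y in Ω, {q : Euc 1 × Euc 1 | q.2 0 < q.1 0}.indicator
        (fun q => fderiv ℝ φ q.1 lineVec * w q.2) (x, y) := by
    refine integral_congr_ae ?_
    filter_upwards [(memLp_linePrimitive w).coeFn_toLp] with x hx
    rw [hx, inner_smul_left, real_inner_comm, ← InnerProductSpace.toDual_apply_apply (𝕜 := ℝ),
      toDual_gradient, RCLike.conj_to_real, mul_comm, linePrimitive, ← integral_const_mul]
    refine integral_congr_ae (Filter.Eventually.of_forall fun y => ?_)
    simp [indicator]
  have hint := (hgi.mul_prod (integrable_L2Scal w)).indicator measurableSet_coord_lt_prod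
  rw [e1, integral_integral_swap (f := fun x y => {q : Euc 1 × Euc 1 | q.2 0 < q.1 0}.indicator
    (fun q => fderiv ℝ φ q.1 lineVec * w q.2) (x, y)) hint, ← integral_neg]
  refine integral_congr_ae (Filter.Eventually.of_forall fun y => ?_)
  have hS : MeasurableSet {x : Euc 1 | y 0 < x 0} :=
    (isOpen_lt continuous_const (by fun_prop)).measurableSet
  have e2 : ∀ x, {q : Euc 1 × Euc 1 | q.2 0 < q.1 0}.indicator
      (fun q => fderiv ℝ φ q.1 lineVec * w q.2) (x, y) =
      w y * {x : Euc 1 | y 0 < x 0}.indicator (fun x => fderiv ℝ φ x lineVec) x := by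
    intro x
    by_cases h : y 0 < x 0 <;> simp [indicator, h, mul_comm]
  simp only [e2]
  rw [integral_const_mul, setIntegral_eq_integral_of_forall_compl_eq_zero, integral_indicator hS,
    setIntegral_fderiv_lineVec hφ1 hc]
  · ring
  · intro x hx
    have : fderiv ℝ φ x = 0 := by
      refine image_eq_zero_of_notMem_tsupport fun h => hx (hs (tsupport_fderiv_subset ℝ h))
    simp [indicator, this]

end Primitive

namespace SimplicialMesh

variable {Ω : Set (Euc 1)}

/-- The primitive is affine with slope `c` on a cell, so the field built from it belongs to `V_h`.
The null set hypothesis makes the length of a subinterval equal to its measure inside `Ω`. -/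
theorem linePrimitive_sub_eq [IsFiniteMeasure (volume.restrict Ω)] {C : Set (Euc 1)}
    (hC : Convex ℝ C) (hCΩ : volume (C \ Ω) = 0) {w : L2Scal Ω} {c : ℝ}
    (hw : ∀ᵐ x ∂(volume.restrict Ω), x ∈ C → w x = c) {a b : Euc 1} (ha : a ∈ C) (hb : b ∈ C)
    (hab : a 0 ≤ b 0) : linePrimitive w b - linePrimitive w a = c * (b 0 - a 0) := by
  have hS : MeasurableSet {y : Euc 1 | a 0 ≤ y 0 ∧ y 0 < b 0} :=
    lineCoord.measurable measurableSet_Ico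
  have hsub : {y : Euc 1 | a 0 ≤ y 0 ∧ y 0 < b 0} ⊆ C := fun y hy =>
    hC.mem_of_coord_mem_Icc ha hb hy.1 hy.2.le
  rw [linePrimitive, linePrimitive,
    ← integral_sub ((integrable_L2Scal w).indicator (measurableSet_coord_lt b))
      ((integrable_L2Scal w).indicator (measurableSet_coord_lt a))]
  have e1 : ∀ᵐ y ∂(volume.restrict Ω), {y : Euc 1 | y 0 < b 0}.indicator w y -
      {y : Euc 1 | y 0 < a 0}.indicator w y =
      {y : Euc 1 | a 0 ≤ y 0 ∧ y 0 < b 0}.indicator (fun _ => c) y := by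
    filter_upwards [hw] with y hy
    by_cases h1 : y 0 < a 0
    · simp [indicator, h1, h1.trans_le hab, not_le.2 h1]
    · by_cases h2 : y 0 < b 0
      · have := hy (hsub ⟨not_lt.1 h1, h2⟩)
        simp [indicator, h1, h2, not_lt.1 h1, this]
      · simp [indicator, h1, h2]
  rw [integral_congr_ae e1, integral_indicator hS, setIntegral_const, smul_eq_mul,
    measureReal_restrict_apply hS, mul_comm, ← volume_real_coord_Ico hab]
  congr 1
  refine measureReal_congr (inter_subset_left.eventuallyLE.antisymm ?_)
  rw [ae_le_set]
  have hdiff : {y : Euc 1 | a 0 ≤ y 0 ∧ y 0 < b 0} \ ({y : Euc 1 | a 0 ≤ y 0 ∧ y 0 < b 0} ∩ Ω) ⊆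
      C \ Ω := fun y hy => ⟨hsub hy.1, fun h => hy.2 ⟨hy.1, h⟩⟩
  exact measure_mono_null hdiff hCΩ

/-- The primitive has divergence exactly `w`, so the pairing equals `‖w‖²`, and the norm of the
primitive is at most `|Ω| ‖w‖` on any mesh. -/
theorem exists_infsup_of_eq_one (hΩo : IsOpen Ω) (hΩb : Bornology.IsBounded Ω)
    (h0 : volume (frontier Ω) = 0) :
    ∃ C : ℝ, 0 < C ∧ ∀ M : SimplicialMesh Ω, ∀ w ∈ M.Wh, ∃ v ∈ M.Vh,
      ‖w‖ ^ 2 ≤ C * ∫ x in Ω, w x * v.div x ∧ ‖v.toL2‖ ^ 2 ≤ C * ∫ x in Ω, w x * v.div x := by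
  have : IsFiniteMeasure (volume.restrict Ω) := ⟨by simpa using hΩb.measure_lt_top⟩
  refine ⟨1 + volume.real Ω ^ 2, by positivity, fun M w hw => ?_⟩
  let v : Hdiv Ω := ⟨(memLp_linePrimitive w).toLp, w, hasWeakDiv_linePrimitive w⟩
  have hdiv : v.div = w := Hdiv.div_eq_of_hasWeakDiv hΩo v w (hasWeakDiv_linePrimitive w)
  have hv : (v.toL2 : Euc 1 → Euc 1) =ᵐ[volume.restrict Ω] fun x => linePrimitive w x • lineVec :=
    (memLp_linePrimitive w).coeFn_toLp
  refine ⟨v, fun T hT => ?_, ?_⟩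
  · obtain ⟨c, hc⟩ := hw T hT
    have hnull : volume (convexHull ℝ (T : Set (Euc 1)) \ Ω) = 0 := by
      refine measure_mono_null (fun x hx => ?_) h0
      rw [hΩo.frontier_eq]
      exact ⟨M.convexHull_subset hT hx.1, hx.2⟩
    obtain ⟨z, hz⟩ : T.Nonempty := Finset.card_pos.1 (by rw [M.card_eq T hT]; omega)
    have hz' := subset_convexHull ℝ (T : Set (Euc 1)) hz
    refine ⟨linePrimitive w z • lineVec - c • z, c, ?_⟩
    filter_upwards [hv] with x hx hxT
    have key : linePrimitive w x - linePrimitive w z = c * (x 0 - z 0) := by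
      rcases le_total (z 0) (x 0) with h | h
      · exact linePrimitive_sub_eq (convex_convexHull ℝ _) hnull hc hz' hxT h
      · have := linePrimitive_sub_eq (convex_convexHull ℝ _) hnull hc hxT hz' h
        linarith
    have h1 : linePrimitive w x = linePrimitive w z + c * (x 0 - z 0) := by linarith
    rw [hx, h1, add_smul, mul_smul, sub_smul, smul_lineVec, smul_lineVec, smul_sub]
    abel
  · have hI : ∫ x in Ω, w x * v.div x = ‖w‖ ^ 2 := by
      rw [hdiv, norm_sq_eq_setIntegral]
      refine integral_congr_ae (Filter.Eventually.of_forall fun x => ?_)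
      simp only [Real.norm_eq_abs, sq_abs]
      ring
    rw [hI]
    have hw0 := sq_nonneg ‖w‖
    have hV0 := sq_nonneg (volume.real Ω)
    constructor
    · nlinarith
    · have h2 : ‖v.toL2‖ ^ 2 ≤ volume.real Ω * (volume.real Ω * ‖w‖ ^ 2) := by
        rw [norm_sq_eq_setIntegral]
        calc ∫ x in Ω, ‖v.toL2 x‖ ^ 2 ≤ ∫ x in Ω, volume.real Ω * ‖w‖ ^ 2 := by
              refine integral_mono_ae ?_ (integrable_const _) ?_
              · exact (Lp.memLp v.toL2).integrable_norm_pow (by norm_num)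
              · filter_upwards [hv] with x hx
                rw [hx, norm_smul, norm_lineVec, mul_one, Real.norm_eq_abs, sq_abs]
                exact abs_linePrimitive_sq_le w x
          _ = _ := by rw [setIntegral_const, smul_eq_mul]
      nlinarith

/-- The uniform inf-sup condition of the lowest order Raviart-Thomas element. -/
theorem exists_infsup {d : ℕ} {Ω : Set (Euc d)} (hd : 1 ≤ d) (hΩo : IsOpen Ω)
    (hΩb : Bornology.IsBounded Ω) (h0 : volume (frontier Ω) = 0) (σ : ℝ) :
    ∃ C : ℝ, 0 < C ∧ ∀ M : SimplicialMesh Ω, M.IsShapeRegular σ → ∀ w ∈ M.Wh, ∃ v ∈ M.Vh,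
      ‖w‖ ^ 2 ≤ C * ∫ x in Ω, w x * v.div x ∧ ‖v.toL2‖ ^ 2 ≤ C * ∫ x in Ω, w x * v.div x := by
  rcases eq_or_lt_of_le hd with rfl | h
  · obtain ⟨C, hC, h⟩ := exists_infsup_of_eq_one hΩo hΩb h0
    exact ⟨C, hC, fun M _ => h M⟩
  · exact exists_infsup_of_two_le h hΩo hΩb h0 σ

end SimplicialMesh

/-! ### Integrals as `L²` inner products, and differences of discrete functions. -/

section L2

variable {X : Type*} [MeasurableSpace X] {μ : Measure X}

theorem integral_inner_eq_inner_toLp {F : Type*} [NormedAddCommGroup F] [InnerProductSpace ℝ F]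
    {f : X → F} (hf : MemLp f 2 μ) (v : Lp F 2 μ) :
    ∫ x, inner ℝ (f x) (v x) ∂μ = inner ℝ hf.toLp v := by
  rw [L2.inner_def]
  refine integral_congr_ae ?_
  filter_upwards [hf.coeFn_toLp] with x hx
  rw [hx]

theorem integral_mul_eq_inner_toLp {f : X → ℝ} (hf : MemLp f 2 μ) (w : Lp ℝ 2 μ) :
    ∫ x, f x * w x ∂μ = inner ℝ hf.toLp w := by
  rw [← integral_inner_eq_inner_toLp hf w]
  simp [mul_comm]

theorem integral_mul_eq_inner (v w : Lp ℝ 2 μ) : ∫ x, v x * w x ∂μ = inner ℝ v w := by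
  rw [L2.inner_def]
  simp [mul_comm]

theorem Lp_norm_le_of_ae_le_add {E F G : Type*} [NormedAddCommGroup E] [NormedAddCommGroup F]
    [NormedAddCommGroup G] {f : Lp E 2 μ} {g : Lp F 2 μ} {h : Lp G 2 μ} {b k : ℝ} (hb : 0 ≤ b)
    (hk : 0 ≤ k) (H : ∀ᵐ x ∂μ, ‖f x‖ ≤ b * ‖g x‖ + k * ‖h x‖) : ‖f‖ ≤ b * ‖g‖ + k * ‖h‖ := by
  have hg : MemLp (fun x => ‖g x‖) 2 μ := (Lp.memLp g).norm
  have hh : MemLp (fun x => ‖h x‖) 2 μ := (Lp.memLp h).norm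
  have e1 : ‖hg.toLp‖ = ‖g‖ := by rw [Lp.norm_toLp, eLpNorm_norm, Lp.norm_def]
  have e2 : ‖hh.toLp‖ = ‖h‖ := by rw [Lp.norm_toLp, eLpNorm_norm, Lp.norm_def]
  have key : ‖f‖ ≤ ‖b • hg.toLp + k • hh.toLp‖ := by
    refine Lp.norm_le_norm_of_ae_le ?_
    filter_upwards [H, Lp.coeFn_add (b • hg.toLp) (k • hh.toLp), Lp.coeFn_smul b hg.toLp,
      Lp.coeFn_smul k hh.toLp, hg.coeFn_toLp, hh.coeFn_toLp] with x h0 h1 h2 h3 h4 h5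
    rw [h1, Pi.add_apply, h2, h3, Pi.smul_apply, Pi.smul_apply, h4, h5]
    exact h0.trans (le_abs_self _)
  refine key.trans ((norm_add_le _ _).trans (le_of_eq ?_))
  rw [norm_smul, norm_smul, e1, e2, Real.norm_eq_abs, Real.norm_eq_abs, abs_of_nonneg hb,
    abs_of_nonneg hk]

end L2

namespace Hdiv

variable {d : ℕ} {Ω : Set (Euc d)}

theorem hasWeakDiv_sub (v w : Hdiv Ω) : HasWeakDiv Ω (v.toL2 - w.toL2) (v.div - w.div) := by
  intro φ hφ hc hs
  have hφ1 : ContDiff ℝ 1 φ := hφ.of_le (by exact_mod_cast le_top)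
  have hgc : Continuous (gradient φ) :=
    (LinearIsometryEquiv.continuous _).comp (hφ1.continuous_fderiv (by norm_num))
  have hgs : HasCompactSupport (gradient φ) :=
    (hc.fderiv ℝ).comp_left (map_zero (InnerProductSpace.toDual ℝ (Euc d)).symm)
  have hg2 : MemLp (gradient φ) 2 (volume.restrict Ω) :=
    (hgc.memLp_of_hasCompactSupport hgs).restrict Ω
  have hφ2 : MemLp φ 2 (volume.restrict Ω) :=
    (hφ.continuous.memLp_of_hasCompactSupport hc).restrict Ω
  have h1 : ∀ f : L2Vec Ω, ∫ x in Ω, inner ℝ (f x) (gradient φ x) = inner ℝ hg2.toLp f := by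
    intro f
    rw [← integral_inner_eq_inner_toLp]
    simp only [real_inner_comm]
  have h2 : ∀ g : L2Scal Ω, ∫ x in Ω, g x * φ x = inner ℝ hφ2.toLp g := by
    intro f
    rw [← integral_mul_eq_inner_toLp]
    simp only [mul_comm]
  have h3 := v.hasWeakDiv_div φ hφ hc hs
  have h4 := w.hasWeakDiv_div φ hφ hc hs
  rw [h1, h2] at h3 h4 ⊢
  rw [inner_sub_right, inner_sub_right, h3, h4]
  ring

/-- The difference of two fields in `H(div; Ω)`. -/
def sub (v w : Hdiv Ω) : Hdiv Ω := ⟨v.toL2 - w.toL2, _, hasWeakDiv_sub v w⟩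

theorem toL2_sub (v w : Hdiv Ω) : (v.sub w).toL2 = v.toL2 - w.toL2 := rfl

theorem div_sub (hΩo : IsOpen Ω) (v w : Hdiv Ω) : (v.sub w).div = v.div - w.div :=
  div_eq_of_hasWeakDiv hΩo _ _ (hasWeakDiv_sub v w)

end Hdiv

namespace SimplicialMesh

variable {d : ℕ} {Ω : Set (Euc d)}

theorem sub_mem_Wh {M : SimplicialMesh Ω} {v w : L2Scal Ω} (hv : v ∈ M.Wh) (hw : w ∈ M.Wh) :
    v - w ∈ M.Wh := by
  intro T hT
  obtain ⟨a, ha⟩ := hv T hT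
  obtain ⟨b, hb⟩ := hw T hT
  refine ⟨a - b, ?_⟩
  filter_upwards [ha, hb, Lp.coeFn_sub v w] with x h1 h2 h3 hx
  rw [h3, Pi.sub_apply, h1 hx, h2 hx]

theorem sub_mem_Vh {M : SimplicialMesh Ω} {v w : Hdiv Ω} (hv : v ∈ M.Vh) (hw : w ∈ M.Vh) :
    v.sub w ∈ M.Vh := by
  intro T hT
  obtain ⟨a, b, ha⟩ := hv T hT
  obtain ⟨a', b', hb⟩ := hw T hT
  refine ⟨a - a', b - b', ?_⟩
  filter_upwards [ha, hb, Lp.coeFn_sub v.toL2 w.toL2] with x h1 h2 h3 hx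
  rw [Hdiv.toL2_sub, h3, Pi.sub_apply, h1 hx, h2 hx, sub_smul]
  abel

end SimplicialMesh

/-! ### The scalar inequalities that determine the time step. -/

/-- The coercivity estimate behind uniqueness for small time steps. -/
theorem exists_timeStep_collapse {L k b aLow aUp C : ℝ} (hL : 0 < L) (hk : 0 ≤ k)
    (ha : 0 < aLow) (ha' : 0 ≤ aUp) (hC : 0 < C) :
    ∃ τ₀ : ℝ, 0 < τ₀ ∧ ∀ τ : ℝ, 0 < τ → τ ≤ τ₀ → ∀ s q u p X : ℝ, 0 ≤ s → 0 ≤ q → 0 ≤ u →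
      0 ≤ p → s ^ 2 ≤ L * X → X + τ * q ^ 2 ≤ τ * ((b * u + k * s) * q) →
      p ≤ C * (aUp * u + k * s) → aLow * u ^ 2 ≤ k * s * u + k * s * p →
      s = 0 ∧ q = 0 ∧ u = 0 ∧ p = 0 := by
  -- Eliminating `p` gives `aLow * u² ≤ e * s * u + k * C * k * s²`; Young's inequality turns this
  -- into `u² ≤ K * s²`, and then `(b * u + k * s)² ≤ 2 * N * s²`.
  set e := k + k * C * aUp with he
  set K := (e ^ 2 / aLow + 2 * (k * C * k)) / aLow with hK
  have he0 : 0 ≤ e := by positivity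
  have hK0 : 0 ≤ K := by positivity
  set N := b ^ 2 * K + k ^ 2 with hN
  have hN0 : 0 ≤ N := by positivity
  -- This makes `τ * N ≤ 1 / (2 * L)`, so that `s² / L ≤ X ≤ τ * N * s² ≤ s² / (2 * L)`, which
  -- forces `s = 0`. Adding 1 to `N` covers the case `N = 0`.
  refine ⟨1 / (2 * L * (N + 1)), by positivity, ?_⟩
  intro τ hτ hτ0 s q u p X hs hq hu hp h1 h2 h3 h4
  have h5 : aLow * u ^ 2 ≤ e * (s * u) + k * C * k * s ^ 2 := by
    have : k * s * p ≤ k * s * (C * (aUp * u + k * s)) := by gcongr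
    calc aLow * u ^ 2 ≤ k * s * u + k * s * p := h4
      _ ≤ k * s * u + k * s * (C * (aUp * u + k * s)) := by gcongr
      _ = _ := by rw [he]; ring
  have h6 : u ^ 2 ≤ K * s ^ 2 := by
    have h7 : e * (s * u) ≤ aLow / 2 * u ^ 2 + e ^ 2 / (2 * aLow) * s ^ 2 := by
      have : aLow / 2 * u ^ 2 + e ^ 2 / (2 * aLow) * s ^ 2 - e * (s * u) =
          (aLow * u - e * s) ^ 2 / (2 * aLow) := by field_simp; ring
      have h8 : 0 ≤ (aLow * u - e * s) ^ 2 / (2 * aLow) := by positivity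
      linarith
    have h9 : aLow * u ^ 2 ≤ (e ^ 2 / aLow + 2 * (k * C * k)) * s ^ 2 := by
      have : e ^ 2 / (2 * aLow) * s ^ 2 = e ^ 2 / aLow * s ^ 2 / 2 := by field_simp
      nlinarith
    rw [hK, div_mul_eq_mul_div, le_div_iff₀ ha]
    linarith
  have h7 : (b * u + k * s) ^ 2 ≤ 2 * (N * s ^ 2) := by
    have := mul_le_mul_of_nonneg_left h6 (sq_nonneg b)
    nlinarith [sq_nonneg (b * u - k * s)]
  have h8 : X + τ / 2 * q ^ 2 ≤ τ * (N * s ^ 2) := by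
    have : (b * u + k * s) * q ≤ q ^ 2 / 2 + N * s ^ 2 := by
      nlinarith [sq_nonneg (b * u + k * s - q)]
    have := mul_le_mul_of_nonneg_left this hτ.le
    nlinarith
  have h9 : τ * N ≤ 1 / (2 * L) := by
    have h10 : τ * (N + 1) ≤ 1 / (2 * L) := by
      have := mul_le_mul_of_nonneg_right hτ0 (by linarith : (0 : ℝ) ≤ N + 1)
      refine this.trans (le_of_eq ?_)
      field_simp
    nlinarith
  have h10 : s ^ 2 / L ≤ X := by rw [div_le_iff₀ hL]; linarith
  have h11 : τ * (N * s ^ 2) ≤ s ^ 2 / L / 2 := by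
    have := mul_le_mul_of_nonneg_right h9 (sq_nonneg s)
    calc τ * (N * s ^ 2) = τ * N * s ^ 2 := by ring
      _ ≤ 1 / (2 * L) * s ^ 2 := this
      _ = _ := by field_simp
  have h12 : 0 ≤ τ / 2 * q ^ 2 := by positivity
  have h13 : 0 ≤ s ^ 2 / L := by positivity
  have hs0 : s = 0 := by
    have : s ^ 2 / L = 0 := by linarith
    rcases div_eq_zero_iff.1 this with h | h
    · exact pow_eq_zero_iff (by norm_num) |>.1 h
    · exact absurd h hL.ne'
  subst hs0
  have hq0 : q = 0 := by
    have h14 : τ / 2 * q ^ 2 = 0 := by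
      simp only [ne_eq, OfNat.ofNat_ne_zero, not_false_eq_true, zero_pow, zero_div, mul_zero] at *
      linarith
    rcases mul_eq_zero.1 h14 with h | h
    · linarith
    · exact pow_eq_zero_iff (by norm_num) |>.1 h
  have hu0 : u = 0 := by
    have : u ^ 2 ≤ 0 := by simpa using h6
    exact pow_eq_zero_iff (by norm_num : (2 : ℕ) ≠ 0) |>.1 (le_antisymm this (sq_nonneg u))
  subst hu0
  refine ⟨rfl, hq0, rfl, le_antisymm (by simpa using h3) hp⟩

/-! ### Nonlinear coefficients as maps of `L²`. -/

section Coefficients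

variable {d : ℕ} {Ω : Set (Euc d)} {c : FlowCoeffs d}

theorem FlowCoeffs.Admissible.aestronglyMeasurable_comp {F : Type*} [NormedAddCommGroup F]
    (hc : c.Admissible) {f : ℝ → F} (hf : Continuous f) (Θ : L2Scal Ω) :
    AEStronglyMeasurable (fun x => f (c.s (Θ x))) (volume.restrict Ω) := by
  obtain ⟨K, hK⟩ := hc.s_lip
  exact (hf.comp hK.continuous).comp_aestronglyMeasurable (Lp.aestronglyMeasurable Θ)

/-- The saturation lies in `[0, 1]`, where a continuous function is bounded. With `f = id` this
yields the saturation itself, which is how `compL2` with `continuous_id` is to be read below. -/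
theorem FlowCoeffs.Admissible.memLp_comp {F : Type*} [NormedAddCommGroup F]
    (hc : c.Admissible) (hΩ : volume Ω ≠ ⊤) {f : ℝ → F} (hf : Continuous f) (Θ : L2Scal Ω) :
    MemLp (fun x => f (c.s (Θ x))) 2 (volume.restrict Ω) := by
  have : IsFiniteMeasure (volume.restrict Ω) := ⟨by simpa using hΩ.lt_top⟩
  obtain ⟨C, hC⟩ := (isCompact_Icc (a := (0 : ℝ)) (b := 1)).exists_bound_of_continuousOn
    hf.continuousOn
  exact MemLp.of_bound (hc.aestronglyMeasurable_comp hf Θ) C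
    (Filter.Eventually.of_forall fun x => hC _ (hc.s_mem _))

theorem FlowCoeffs.Admissible.memLp_comp_smul (hc : c.Admissible) {f : ℝ → ℝ} (hf : Continuous f)
    (Θ : L2Scal Ω) (u : L2Vec Ω) :
    MemLp (fun x => f (c.s (Θ x)) • u x) 2 (volume.restrict Ω) := by
  obtain ⟨C, hC⟩ := (isCompact_Icc (a := (0 : ℝ)) (b := 1)).exists_bound_of_continuousOn
    hf.continuousOn
  refine MemLp.of_le_mul (c := C) (Lp.memLp u)
    ((hc.aestronglyMeasurable_comp hf Θ).smul (Lp.aestronglyMeasurable u))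
    (Filter.Eventually.of_forall fun x => ?_)
  rw [norm_smul]
  exact mul_le_mul_of_nonneg_right (hC _ (hc.s_mem _)) (norm_nonneg _)

/-- A function of the saturation, as an element of `L²`. -/
def FlowCoeffs.Admissible.compL2 {F : Type*} [NormedAddCommGroup F]
    (hc : c.Admissible) (hΩ : volume Ω ≠ ⊤) {f : ℝ → F} (hf : Continuous f) (Θ : L2Scal Ω) :
    Lp F 2 (volume.restrict Ω) := (hc.memLp_comp hΩ hf Θ).toLp

/-- The product of a function of the saturation with a field, as an element of `L²(Ω)ᵈ`. -/
def FlowCoeffs.Admissible.smulL2 (hc : c.Admissible) {f : ℝ → ℝ} (hf : Continuous f)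
    (Θ : L2Scal Ω) (u : L2Vec Ω) : L2Vec Ω := (hc.memLp_comp_smul hf Θ u).toLp

theorem FlowCoeffs.Admissible.coeFn_compL2 {F : Type*} [NormedAddCommGroup F]
    (hc : c.Admissible) (hΩ : volume Ω ≠ ⊤) {f : ℝ → F} (hf : Continuous f) (Θ : L2Scal Ω) :
    hc.compL2 hΩ hf Θ =ᵐ[volume.restrict Ω] fun x => f (c.s (Θ x)) :=
  (hc.memLp_comp hΩ hf Θ).coeFn_toLp

theorem FlowCoeffs.Admissible.coeFn_smulL2 (hc : c.Admissible) {f : ℝ → ℝ} (hf : Continuous f)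
    (Θ : L2Scal Ω) (u : L2Vec Ω) :
    hc.smulL2 hf Θ u =ᵐ[volume.restrict Ω] fun x => f (c.s (Θ x)) • u x :=
  (hc.memLp_comp_smul hf Θ u).coeFn_toLp

theorem FlowCoeffs.Admissible.norm_compL2_sub_le {F : Type*} [NormedAddCommGroup F]
    (hc : c.Admissible) (hΩ : volume Ω ≠ ⊤) {f : ℝ → F} {K : ℝ≥0} (hf : LipschitzWith K f)
    (Θ Θ' : L2Scal Ω) : ‖hc.compL2 hΩ hf.continuous Θ - hc.compL2 hΩ hf.continuous Θ'‖ ≤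
      K * ‖hc.compL2 hΩ continuous_id Θ - hc.compL2 hΩ continuous_id Θ'‖ := by
  refine Lp.norm_le_mul_norm_of_ae_le_mul ?_
  filter_upwards [hc.coeFn_compL2 hΩ hf.continuous Θ, hc.coeFn_compL2 hΩ hf.continuous Θ',
    hc.coeFn_compL2 hΩ continuous_id Θ, hc.coeFn_compL2 hΩ continuous_id Θ',
    Lp.coeFn_sub (hc.compL2 hΩ hf.continuous Θ) (hc.compL2 hΩ hf.continuous Θ'),
    Lp.coeFn_sub (hc.compL2 hΩ continuous_id Θ) (hc.compL2 hΩ continuous_id Θ')]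
    with x h1 h2 h3 h4 h5 h6
  rw [h5, h6, Pi.sub_apply, Pi.sub_apply, h1, h2, h3, h4]
  exact hf.norm_sub_le _ _

/-- The product difference is split so that the variation of `f` multiplies `u'` alone. Here the
supremum bound of (A4) is indispensable: the saturation difference is only measured in `L²`. -/
theorem FlowCoeffs.Admissible.norm_smulL2_sub_le (hc : c.Admissible) (hΩ : volume Ω ≠ ⊤)
    {f : ℝ → ℝ} {K : ℝ≥0} (hf : LipschitzWith K f) {B m : ℝ} (hB : ∀ y, |f y| ≤ B)
    (Θ Θ' : L2Scal Ω) (u u' : L2Vec Ω) (hu' : ∀ᵐ x ∂(volume.restrict Ω), ‖u' x‖ ≤ m)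
    (hm : 0 ≤ m) :
    ‖hc.smulL2 hf.continuous Θ u - hc.smulL2 hf.continuous Θ' u'‖ ≤
      B * ‖u - u'‖ + K * m * ‖hc.compL2 hΩ continuous_id Θ - hc.compL2 hΩ continuous_id Θ'‖ := by
  have hB0 : 0 ≤ B := (abs_nonneg _).trans (hB 0)
  refine Lp_norm_le_of_ae_le_add hB0 (by positivity) ?_
  filter_upwards [hc.coeFn_smulL2 hf.continuous Θ u, hc.coeFn_smulL2 hf.continuous Θ' u',
    hc.coeFn_compL2 hΩ continuous_id Θ, hc.coeFn_compL2 hΩ continuous_id Θ',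
    Lp.coeFn_sub (hc.smulL2 hf.continuous Θ u) (hc.smulL2 hf.continuous Θ' u'),
    Lp.coeFn_sub (hc.compL2 hΩ continuous_id Θ) (hc.compL2 hΩ continuous_id Θ'),
    Lp.coeFn_sub u u', hu']
    with x h1 h2 h3 h4 h5 h6 h7 h8
  rw [h5, h6, h7, Pi.sub_apply, Pi.sub_apply, Pi.sub_apply, h1, h2, h3, h4]
  simp only [id]
  have e : f (c.s (Θ x)) • u x - f (c.s (Θ' x)) • u' x =
      f (c.s (Θ x)) • (u x - u' x) + (f (c.s (Θ x)) - f (c.s (Θ' x))) • u' x := by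
    rw [smul_sub, sub_smul]; abel
  rw [e]
  refine (norm_add_le _ _).trans ?_
  rw [norm_smul, norm_smul]
  have h9 := hf.norm_sub_le (c.s (Θ x)) (c.s (Θ' x))
  calc ‖f (c.s (Θ x))‖ * ‖u x - u' x‖ + ‖f (c.s (Θ x)) - f (c.s (Θ' x))‖ * ‖u' x‖
      ≤ B * ‖u x - u' x‖ + (K * ‖c.s (Θ x) - c.s (Θ' x)‖) * m := by
        gcongr
        exact hB _
    _ = _ := by ring

/-- Coercivity up to a perturbation: with the same splitting, `f(s)(u - u')` is coercive and the
remainder is controlled by the bound on `u'`. -/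
theorem FlowCoeffs.Admissible.le_inner_smulL2 (hc : c.Admissible) (hΩ : volume Ω ≠ ⊤)
    {f : ℝ → ℝ} {K : ℝ≥0} (hf : LipschitzWith K f) {A m : ℝ} (hA : ∀ y, A ≤ f y)
    (Θ Θ' : L2Scal Ω) (u u' : L2Vec Ω) (hu' : ∀ᵐ x ∂(volume.restrict Ω), ‖u' x‖ ≤ m) :
    A * ‖u - u'‖ ^ 2 ≤
      inner ℝ (hc.smulL2 hf.continuous Θ u - hc.smulL2 hf.continuous Θ' u') (u - u') +
      K * m * ‖hc.compL2 hΩ continuous_id Θ - hc.compL2 hΩ continuous_id Θ'‖ * ‖u - u'‖ := by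
  set D := hc.smulL2 hf.continuous Θ u - hc.smulL2 hf.continuous Θ' u'
  set S := hc.compL2 hΩ continuous_id Θ - hc.compL2 hΩ continuous_id Θ'
  set W := hc.smulL2 hf.continuous Θ (u - u') with hW
  have h1 : ‖D - W‖ ≤ K * m * ‖S‖ := by
    refine Lp.norm_le_mul_norm_of_ae_le_mul ?_
    filter_upwards [hc.coeFn_smulL2 hf.continuous Θ u, hc.coeFn_smulL2 hf.continuous Θ' u',
      hc.coeFn_compL2 hΩ continuous_id Θ, hc.coeFn_compL2 hΩ continuous_id Θ',
      Lp.coeFn_sub (hc.smulL2 hf.continuous Θ u) (hc.smulL2 hf.continuous Θ' u'),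
      Lp.coeFn_sub (hc.compL2 hΩ continuous_id Θ) (hc.compL2 hΩ continuous_id Θ'),
      Lp.coeFn_sub u u', hu', Lp.coeFn_sub D W, hc.coeFn_smulL2 hf.continuous Θ (u - u')]
      with x h1 h2 h3 h4 h5 h6 h7 h8 h9 h10
    rw [h9, h6, Pi.sub_apply, Pi.sub_apply, h5, h10, h7, Pi.sub_apply, Pi.sub_apply, h1, h2, h3, h4]
    simp only [id]
    have e : f (c.s (Θ x)) • u x - f (c.s (Θ' x)) • u' x - f (c.s (Θ x)) • (u x - u' x) =
        (f (c.s (Θ x)) - f (c.s (Θ' x))) • u' x := by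
      rw [smul_sub, sub_smul]; abel
    rw [e, norm_smul]
    have h11 := hf.norm_sub_le (c.s (Θ x)) (c.s (Θ' x))
    calc ‖f (c.s (Θ x)) - f (c.s (Θ' x))‖ * ‖u' x‖
        ≤ (K * ‖c.s (Θ x) - c.s (Θ' x)‖) * m := by gcongr
      _ = _ := by ring
  have h2 : A * ‖u - u'‖ ^ 2 ≤ inner ℝ W (u - u') := by
    rw [← real_inner_self_eq_norm_sq, L2.inner_def, L2.inner_def, ← integral_const_mul]
    refine integral_mono_ae ((L2.integrable_inner _ _).const_mul _) (L2.integrable_inner _ _) ?_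
    filter_upwards [hc.coeFn_smulL2 hf.continuous Θ (u - u')] with x hx
    rw [hx, inner_smul_left, RCLike.conj_to_real]
    exact mul_le_mul_of_nonneg_right (hA _) real_inner_self_nonneg
  have h3 : inner ℝ D (u - u') = inner ℝ (D - W) (u - u') + inner ℝ W (u - u') := by
    rw [← inner_add_left, sub_add_cancel]
  have h4 := (abs_le.1 (abs_real_inner_le_norm (D - W) (u - u'))).1
  have h5 : ‖D - W‖ * ‖u - u'‖ ≤ K * m * ‖S‖ * ‖u - u'‖ := by gcongr
  linarith

/-- Pointwise, `s(Θ) - s(Θ')` has the sign of `Θ - Θ'` and at most `K` times its size. Writing `K +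
1` keeps the constant positive for the division by it later. -/
theorem FlowCoeffs.Admissible.norm_sq_saturation_sub_le (hc : c.Admissible) (hΩ : volume Ω ≠ ⊤)
    {K : ℝ≥0} (hK : LipschitzWith K c.s) (Θ Θ' : L2Scal Ω) :
    ‖hc.compL2 hΩ continuous_id Θ - hc.compL2 hΩ continuous_id Θ'‖ ^ 2 ≤
      (K + 1) * inner ℝ (hc.compL2 hΩ continuous_id Θ - hc.compL2 hΩ continuous_id Θ') (Θ - Θ') := by
  rw [← real_inner_self_eq_norm_sq, L2.inner_def, L2.inner_def, ← integral_const_mul]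
  refine integral_mono_ae (L2.integrable_inner _ _) ((L2.integrable_inner _ _).const_mul _) ?_
  filter_upwards [hc.coeFn_compL2 hΩ continuous_id Θ, hc.coeFn_compL2 hΩ continuous_id Θ',
    Lp.coeFn_sub (hc.compL2 hΩ continuous_id Θ) (hc.compL2 hΩ continuous_id Θ'),
    Lp.coeFn_sub Θ Θ'] with x h1 h2 h3 h4
  rw [h3, h4, Pi.sub_apply, Pi.sub_apply, h1, h2]
  simp only [id, RCLike.inner_apply, conj_trivial]
  have h5 := hK.norm_sub_le (Θ x) (Θ' x)
  rw [Real.norm_eq_abs, Real.norm_eq_abs] at h5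
  have hK0 : (0 : ℝ) ≤ K := K.2
  rcases le_total (Θ x) (Θ' x) with h | h
  · have h6 := hc.s_mono h
    rw [abs_of_nonpos (by linarith), abs_of_nonpos (by linarith)] at h5
    nlinarith
  · have h6 := hc.s_mono h
    rw [abs_of_nonneg (by linarith), abs_of_nonneg (by linarith)] at h5
    nlinarith

end Coefficients

/-! ### Equations for the difference of two solutions, and uniqueness. -/

section Uniqueness

variable {d : ℕ} {Ω : Set (Euc d)} {c : FlowCoeffs d} {M : SimplicialMesh Ω} {τ : ℝ}
  {Θprev : L2Scal Ω} {X Y : FlowState Ω}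

theorem IsDiscreteSolution.saturation_sub (hc : c.Admissible) (hΩ : volume Ω ≠ ⊤)
    (hX : IsDiscreteSolution c M τ Θprev X) (hY : IsDiscreteSolution c M τ Θprev Y) {w : L2Scal Ω}
    (hw : w ∈ M.Wh) :
    inner ℝ (hc.compL2 hΩ continuous_id X.Θ - hc.compL2 hΩ continuous_id Y.Θ) w +
      τ * inner ℝ (X.q.div - Y.q.div) w = 0 := by
  have key : ∀ Z : FlowState Ω, IsDiscreteSolution c M τ Θprev Z →
      inner ℝ (hc.compL2 hΩ continuous_id Z.Θ - hc.compL2 hΩ continuous_id Θprev) w +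
        τ * inner ℝ Z.q.div w = 0 := by
    intro Z hZ
    have h := hZ.saturation_eq w hw
    have hm : MemLp (fun x => c.s (Z.Θ x) - c.s (Θprev x)) 2 (volume.restrict Ω) :=
      (hc.memLp_comp hΩ continuous_id Z.Θ).sub (hc.memLp_comp hΩ continuous_id Θprev)
    rw [integral_mul_eq_inner_toLp hm, integral_mul_eq_inner] at h
    exact h
  have h1 := key X hX
  have h2 := key Y hY
  rw [inner_sub_left] at h1 h2 ⊢
  rw [inner_sub_left]
  linarith

theorem IsDiscreteSolution.flux_sub (hc : c.Admissible) (hΩ : volume Ω ≠ ⊤)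
    (hfw : Continuous c.fw) (hf1 : Continuous c.f1)
    (hX : IsDiscreteSolution c M τ Θprev X) (hY : IsDiscreteSolution c M τ Θprev Y) {v : Hdiv Ω}
    (hv : v ∈ M.Vh) :
    inner ℝ (X.q.toL2 - Y.q.toL2) v.toL2 - inner ℝ (X.Θ - Y.Θ) v.div =
      inner ℝ ((hc.smulL2 hfw X.Θ X.u.toL2 - hc.smulL2 hfw Y.Θ Y.u.toL2) +
        (hc.compL2 hΩ hf1 X.Θ - hc.compL2 hΩ hf1 Y.Θ)) v.toL2 := by
  have key : ∀ Z : FlowState Ω, IsDiscreteSolution c M τ Θprev Z →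
      inner ℝ Z.q.toL2 v.toL2 - inner ℝ Z.Θ v.div - inner ℝ (hc.smulL2 hfw Z.Θ Z.u.toL2) v.toL2 =
        inner ℝ (hc.compL2 hΩ hf1 Z.Θ) v.toL2 := by
    intro Z hZ
    have h := hZ.flux_eq v hv
    rw [← L2.inner_def, integral_mul_eq_inner,
      integral_inner_eq_inner_toLp (hc.memLp_comp_smul hfw Z.Θ Z.u.toL2),
      integral_inner_eq_inner_toLp (hc.memLp_comp hΩ hf1 Z.Θ)] at h
    exact h
  have h1 := key X hX
  have h2 := key Y hY
  simp only [inner_sub_left, inner_add_left]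
  linarith

theorem IsDiscreteSolution.total_flux_sub (hc : c.Admissible) (hΩ : volume Ω ≠ ⊤)
    (hf2 : Continuous c.f2)
    (hX : IsDiscreteSolution c M τ Θprev X) (hY : IsDiscreteSolution c M τ Θprev Y) {w : L2Scal Ω}
    (hw : w ∈ M.Wh) :
    inner ℝ (X.u.div - Y.u.div) w = inner ℝ (hc.compL2 hΩ hf2 X.Θ - hc.compL2 hΩ hf2 Y.Θ) w := by
  have key : ∀ Z : FlowState Ω, IsDiscreteSolution c M τ Θprev Z →
      inner ℝ Z.u.div w = inner ℝ (hc.compL2 hΩ hf2 Z.Θ) w := by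
    intro Z hZ
    have h := hZ.total_flux_eq w hw
    rw [integral_mul_eq_inner, integral_mul_eq_inner_toLp (hc.memLp_comp hΩ hf2 Z.Θ)] at h
    exact h
  rw [inner_sub_left, inner_sub_left, key X hX, key Y hY]

theorem IsDiscreteSolution.pressure_sub (hc : c.Admissible) (hΩ : volume Ω ≠ ⊤)
    (ha : Continuous c.a) (hf3 : Continuous c.f3)
    (hX : IsDiscreteSolution c M τ Θprev X) (hY : IsDiscreteSolution c M τ Θprev Y) {v : Hdiv Ω}
    (hv : v ∈ M.Vh) :
    inner ℝ (X.p - Y.p) v.div =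
      inner ℝ (hc.smulL2 ha X.Θ X.u.toL2 - hc.smulL2 ha Y.Θ Y.u.toL2) v.toL2 +
        inner ℝ (hc.compL2 hΩ hf3 X.Θ - hc.compL2 hΩ hf3 Y.Θ) v.toL2 := by
  have key : ∀ Z : FlowState Ω, IsDiscreteSolution c M τ Θprev Z →
      inner ℝ (hc.smulL2 ha Z.Θ Z.u.toL2) v.toL2 - inner ℝ Z.p v.div +
        inner ℝ (hc.compL2 hΩ hf3 Z.Θ) v.toL2 = 0 := by
    intro Z hZ
    have h := hZ.pressure_eq v hv
    rw [integral_mul_eq_inner,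
      integral_inner_eq_inner_toLp (hc.memLp_comp_smul ha Z.Θ Z.u.toL2),
      integral_inner_eq_inner_toLp (hc.memLp_comp hΩ hf3 Z.Θ)] at h
    exact h
  have h1 := key X hX
  have h2 := key Y hY
  simp only [inner_sub_left]
  linarith

/-- Two states are equal if the differences of their components vanish. -/
theorem FlowState.ext_of_sub_eq_zero (hΘ : X.Θ - Y.Θ = 0) (hq : X.q.toL2 - Y.q.toL2 = 0)
    (hp : X.p - Y.p = 0) (hu : X.u.toL2 - Y.u.toL2 = 0) : X = Y := by
  obtain ⟨Θ, q, p, u⟩ := X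
  obtain ⟨Θ', q', p', u'⟩ := Y
  have h1 : Θ = Θ' := sub_eq_zero.1 hΘ
  have h2 : q = q' := Subtype.ext (sub_eq_zero.1 hq)
  have h3 : p = p' := sub_eq_zero.1 hp
  have h4 : u = u' := Subtype.ext (sub_eq_zero.1 hu)
  rw [h1, h2, h3, h4]

end Uniqueness

theorem mainTheorem5 {d : ℕ} (hd : 1 ≤ d) (Ω : Set (Euc d)) (hΩo : IsOpen Ω)
    (hΩb : Bornology.IsBounded Ω) (hΩl : HasLipschitzBoundary Ω)
    (c : FlowCoeffs d) (hc : c.Admissible) (σ Mu : ℝ) :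
    ∃ τ₀ : ℝ, 0 < τ₀ ∧
      ∀ M : SimplicialMesh Ω, M.IsShapeRegular σ →
        ∀ τ : ℝ, 0 < τ → τ ≤ τ₀ →
          ∀ Θprev : L2Scal Ω, TotalFluxBound c M τ Θprev Mu →
            {X : FlowState Ω | IsDiscreteSolution c M τ Θprev X}.Subsingleton := by
  have h0 := hΩl.volume_frontier hΩo
  have hΩ : volume Ω ≠ ⊤ := hΩb.measure_lt_top.ne
  obtain ⟨C, hC, hinfsup⟩ := SimplicialMesh.exists_infsup hd hΩo hΩb h0 σ
  obtain ⟨Ks, hKs⟩ := hc.s_lip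
  obtain ⟨Ka, hKa⟩ := hc.a_lip
  obtain ⟨K₁, hK₁⟩ := hc.f1_lip
  obtain ⟨K₂, hK₂⟩ := hc.f2_lip
  obtain ⟨K₃, hK₃⟩ := hc.f3_lip
  obtain ⟨Kw, hKw⟩ := hc.fw_lip
  obtain ⟨B, hB⟩ := hc.fw_bdd
  obtain ⟨aLow, aUp, ha0, hab⟩ := hc.a_bounds
  have hB0 : 0 ≤ B := (abs_nonneg _).trans (hB 0)
  have haUp : 0 ≤ aUp := by linarith [(hab 0).1, (hab 0).2]
  have habs : ∀ y, |c.a y| ≤ aUp := fun y => by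
    rw [abs_of_nonneg (by linarith [(hab y).1])]; exact (hab y).2
  have n1 := K₁.coe_nonneg
  have n2 := K₂.coe_nonneg
  have n3 := K₃.coe_nonneg
  have nm := abs_nonneg Mu
  have n4 := mul_nonneg Ka.coe_nonneg nm
  have n5 := mul_nonneg Kw.coe_nonneg nm
  -- A single constant dominating every Lipschitz factor in front of `‖S‖`. The absolute value is
  -- taken because `Mu` may be negative.
  set k : ℝ := Ka * |Mu| + Kw * |Mu| + K₁ + K₂ + K₃
  have hk0 : 0 ≤ k := by positivity
  obtain ⟨τ₀, hτ₀, hcollapse⟩ := exists_timeStep_collapse (L := Ks + 1) (b := B) (by positivity)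
    hk0 ha0 haUp hC
  refine ⟨τ₀, hτ₀, fun M hM τ hτ hττ₀ Θprev hbound X hX Y hY => ?_⟩
  have hYu : ∀ᵐ x ∂(volume.restrict Ω), ‖Y.u.toL2 x‖ ≤ |Mu| := by
    filter_upwards [hbound Y hY] with x hx using hx.trans (le_abs_self _)
  set S := hc.compL2 hΩ continuous_id X.Θ - hc.compL2 hΩ continuous_id Y.Θ
  set Q := X.q.toL2 - Y.q.toL2 with hQ
  set U := X.u.toL2 - Y.u.toL2 with hU
  set P := X.p - Y.p
  set G := (hc.smulL2 hKw.continuous X.Θ X.u.toL2 - hc.smulL2 hKw.continuous Y.Θ Y.u.toL2) +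
        (hc.compL2 hΩ hK₁.continuous X.Θ - hc.compL2 hΩ hK₁.continuous Y.Θ) with hG
  set A := hc.smulL2 hKa.continuous X.Θ X.u.toL2 - hc.smulL2 hKa.continuous Y.Θ Y.u.toL2
  set R := hc.compL2 hΩ hK₂.continuous X.Θ - hc.compL2 hΩ hK₂.continuous Y.Θ
  set H := hc.compL2 hΩ hK₃.continuous X.Θ - hc.compL2 hΩ hK₃.continuous Y.Θ
  have hΘW : X.Θ - Y.Θ ∈ M.Wh := SimplicialMesh.sub_mem_Wh hX.Θ_mem hY.Θ_mem
  have hPW : P ∈ M.Wh := SimplicialMesh.sub_mem_Wh hX.p_mem hY.p_mem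
  have hQV := SimplicialMesh.sub_mem_Vh hX.q_mem hY.q_mem
  have hUV := SimplicialMesh.sub_mem_Vh hX.u_mem hY.u_mem
  have eqS := hX.saturation_sub hc hΩ hY hΘW
  have eqQ := fun v hv => hX.flux_sub (v := v) hc hΩ hKw.continuous hK₁.continuous hY hv
  have eqU := hX.total_flux_sub hc hΩ hK₂.continuous hY hPW
  have eqP := fun v hv => hX.pressure_sub (v := v) hc hΩ hKa.continuous hK₃.continuous hY hv
  have bH : ‖H‖ ≤ K₃ * ‖S‖ := hc.norm_compL2_sub_le hΩ hK₃ X.Θ Y.Θ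
  have bR : ‖R‖ ≤ K₂ * ‖S‖ := hc.norm_compL2_sub_le hΩ hK₂ X.Θ Y.Θ
  have bG : ‖G‖ ≤ B * ‖U‖ + k * ‖S‖ := by
    have h1 := hc.norm_smulL2_sub_le hΩ hKw hB X.Θ Y.Θ X.u.toL2 Y.u.toL2 hYu nm
    have h2 := hc.norm_compL2_sub_le hΩ hK₁ X.Θ Y.Θ
    have h3 : (Kw * |Mu| + K₁) * ‖S‖ ≤ k * ‖S‖ := by gcongr; linarith
    refine (norm_add_le _ _).trans ((add_le_add h1 h2).trans ?_)
    linarith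
  have bA : ‖A + H‖ ≤ aUp * ‖U‖ + k * ‖S‖ := by
    have h1 := hc.norm_smulL2_sub_le hΩ hKa habs X.Θ Y.Θ X.u.toL2 Y.u.toL2 hYu nm
    have h3 : (Ka * |Mu| + K₃) * ‖S‖ ≤ k * ‖S‖ := by gcongr; linarith
    refine (norm_add_le _ _).trans ((add_le_add h1 bH).trans ?_)
    linarith
  have bAU : aLow * ‖U‖ ^ 2 ≤ inner ℝ A U + Ka * |Mu| * ‖S‖ * ‖U‖ :=
    hc.le_inner_smulL2 hΩ hKa (fun y => (hab y).1) X.Θ Y.Θ X.u.toL2 Y.u.toL2 hYu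
  have bS : ‖S‖ ^ 2 ≤ (Ks + 1) * inner ℝ S (X.Θ - Y.Θ) :=
    hc.norm_sq_saturation_sub_le hΩ hKs X.Θ Y.Θ
  -- The flux equation is tested with the flux difference and the saturation equation with the
  -- difference of the `Θ`; the term pairing `Θ` with the divergence of the flux cancels.
  have c2 : inner ℝ S (X.Θ - Y.Θ) + τ * ‖Q‖ ^ 2 ≤ τ * ((B * ‖U‖ + k * ‖S‖) * ‖Q‖) := by
    have h1 := eqQ _ hQV
    rw [Hdiv.toL2_sub, Hdiv.div_sub hΩo, ← hQ, real_inner_self_eq_norm_sq,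
      real_inner_comm (X.q.div - Y.q.div)] at h1
    have h2 : inner ℝ G Q ≤ (B * ‖U‖ + k * ‖S‖) * ‖Q‖ :=
      (real_inner_le_norm _ _).trans (by gcongr)
    have h3 := mul_le_mul_of_nonneg_left h2 hτ.le
    rw [← h1] at h3
    linarith
  have c3 : ‖P‖ ≤ C * (aUp * ‖U‖ + k * ‖S‖) := by
    obtain ⟨v, hv, hv1, hv2⟩ := hinfsup M hM P hPW
    rw [integral_mul_eq_inner] at hv1 hv2
    have h1 := eqP v hv
    rw [← inner_add_left] at h1
    have h2 : inner ℝ P v.div ≤ (aUp * ‖U‖ + k * ‖S‖) * ‖v.toL2‖ := by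
      rw [h1]
      exact (real_inner_le_norm _ _).trans (by gcongr)
    set m := aUp * ‖U‖ + k * ‖S‖ with hm
    have hm0 : 0 ≤ m := by positivity
    set I : ℝ := inner ℝ P v.div
    have hI0 : 0 ≤ I := by
      have : 0 ≤ C * I := (sq_nonneg _).trans hv1
      exact nonneg_of_mul_nonneg_right this hC
    -- From `I ≤ m * ‖v‖` and `‖v‖² ≤ C * I` it follows that `I ≤ m² * C`, and then `‖P‖² ≤ C * I ≤
    -- (C * m)²`.
    have h3 : I * I ≤ m ^ 2 * C * I := by
      calc I * I ≤ (m * ‖v.toL2‖) * (m * ‖v.toL2‖) := by gcongr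
        _ = m ^ 2 * ‖v.toL2‖ ^ 2 := by ring
        _ ≤ m ^ 2 * (C * I) := by gcongr
        _ = m ^ 2 * C * I := by ring
    have h4 : I ≤ m ^ 2 * C := by
      rcases hI0.eq_or_lt with h | h
      · rw [← h]; positivity
      · exact le_of_mul_le_mul_right h3 h
    refine abs_le_of_sq_le_sq' ?_ (by positivity) |>.2
    calc ‖P‖ ^ 2 ≤ C * I := hv1
      _ ≤ C * (m ^ 2 * C) := by gcongr
      _ = (C * m) ^ 2 := by ring
  -- The pressure equation is tested with the total flux difference; the total flux equation, tested
  -- with `P`, replaces the divergence term by one of size `‖S‖ * ‖P‖`.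
  have c4 : aLow * ‖U‖ ^ 2 ≤ k * ‖S‖ * ‖U‖ + k * ‖S‖ * ‖P‖ := by
    have h1 := eqP _ hUV
    rw [Hdiv.toL2_sub, Hdiv.div_sub hΩo, ← hU, real_inner_comm, eqU] at h1
    have h2 : inner ℝ R P ≤ K₂ * ‖S‖ * ‖P‖ := (real_inner_le_norm _ _).trans (by gcongr)
    have h3 : -(K₃ * ‖S‖ * ‖U‖) ≤ inner ℝ H U := by
      have h4 := (abs_le.1 (abs_real_inner_le_norm H U)).1
      have h5 : ‖H‖ * ‖U‖ ≤ K₃ * ‖S‖ * ‖U‖ := by gcongr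
      linarith
    have h6 : (Ka * |Mu| + K₃) * ‖S‖ * ‖U‖ ≤ k * ‖S‖ * ‖U‖ := by gcongr; linarith
    have h7 : K₂ * ‖S‖ * ‖P‖ ≤ k * ‖S‖ * ‖P‖ := by gcongr; linarith
    linarith
  obtain ⟨hS0, hQ0, hU0, hP0⟩ := hcollapse τ hτ hττ₀ ‖S‖ ‖Q‖ ‖U‖ ‖P‖ _ (norm_nonneg _)
    (norm_nonneg _) (norm_nonneg _) (norm_nonneg _) bS c2 c3 c4
  refine FlowState.ext_of_sub_eq_zero ?_ (norm_eq_zero.1 hQ0) (norm_eq_zero.1 hP0)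
    (norm_eq_zero.1 hU0)
  -- Equal saturations do not give equal `Θ`, as `s` may be constant on intervals. With `Q = 0` and
  -- `G = 0` the flux equation says that the difference of the `Θ` is orthogonal to all divergences
  -- from `V_h`, and the inf-sup condition makes it vanish.
  obtain ⟨v, hv, hv1, -⟩ := hinfsup M hM _ hΘW
  rw [integral_mul_eq_inner] at hv1
  have hG0 : G = 0 := by
    rw [hS0, hU0, mul_zero, mul_zero, add_zero] at bG
    exact norm_le_zero_iff.1 bG
  have h1 := eqQ v hv
  rw [← hG, hG0, ← hQ, norm_eq_zero.1 hQ0, inner_zero_left, zero_sub,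
    neg_eq_zero] at h1
  rw [h1, mul_zero] at hv1
  exact norm_eq_zero.1 (pow_eq_zero_iff (by norm_num : (2 : ℕ) ≠ 0) |>.1
    (le_antisymm hv1 (sq_nonneg _)))
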